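/- Let $(M,g)$ be a complete Riemannian manifold (smooth, finite-dimensional, without boundary; complete as a metric space for the Riemannian distance) and let $\nabla$ be any smooth affine connection on $M$, i.e. a smooth connection on $TM$, not assumed to be related to $g$ or to be torsion-free. Let $\gamma : J \to M$, with $J \subseteq \mathbb{R}$ a nonempty open interval, be a maximal nonconstant $\nabla$-geodesic in its affine parameter: $\nabla_{\dot\gamma}\dot\gamma = 0$ on $J$, and $\gamma$ is not the restriction of a $\nabla$-geodesic defined on a strictly larger open interval. An arc-length parametrization of $\gamma$ is a curve $r = \gamma\circ\varphi : S \to M$, where $S$ is an open interval and $\varphi : S \to J$ is a bijective $C^1$ map, with $\|\dot r(s)\|_g = 1$ for all $s \in S$. Then $\gamma$ has an arc-length parametrization, and for every arc-length parametrization $r : S \to M$ of $\gamma$ the parameter runs from $-\infty$ to $\infty$, i.e. $S = \mathbb{R}$. In particular, $\gamma$ has infinite length: $\int_J \|\dot\gamma(t)\|_g\,dt = \infty$. -/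

import Mathlib

open Set MeasureTheory
open scoped Manifold ContDiff Bundle

noncomputable section

namespace AffineGeodesic

variable {E : Type*} [NormedAddCommGroup E] [NormedSpace ℝ E]

section Geodesics

variable {M : Type*} [TopologicalSpace M] [ChartedSpace E M] [IsManifold 𝓘(ℝ, E) ∞ M]

/-- The velocity vector `γ'(t)` of a curve in a manifold. -/
def velocity (γ : ℝ → M) (t : ℝ) : TangentSpace 𝓘(ℝ, E) (γ t) :=
  mfderiv 𝓘(ℝ, ℝ) 𝓘(ℝ, E) γ t (1 : ℝ)

/-- The coordinate vector field `∑ wⁱ ∂/∂xⁱ` with constant components `w ∈ E`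
in the preferred chart at `p`; it is extended by zero outside the domain of the chart. -/
def coordField (p : M) (w : E) (x : M) : TangentSpace 𝓘(ℝ, E) x :=
  (trivializationAt E (TangentSpace 𝓘(ℝ, E)) p).symmL ℝ x w

/-- The components of the tangent vector `v` at `x` in the preferred chart at `p`. -/
def components (p x : M) (v : TangentSpace 𝓘(ℝ, E) x) : E :=
  (trivializationAt E (TangentSpace 𝓘(ℝ, E)) p ⟨x, v⟩).2

/-- The covariant derivative `(DV/dt)(t)` of a vector field `V` along the curve `γ`.
With `∂ᵢ` the coordinate frame of the chart at `γ t` and `V = ∑ Vⁱ ∂ᵢ` near the time `t`, it is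
`∑ (Vⁱ)'(t) ∂ᵢ + ∑ Vⁱ(t) ∇_{γ'(t)} ∂ᵢ`. (The application `cov σ x v` is `(∇_v σ)(x)`.) -/
def covAlong (cov : CovariantDerivative 𝓘(ℝ, E) E (fun x : M ↦ TangentSpace 𝓘(ℝ, E) x))
    (γ : ℝ → M) (V : (t : ℝ) → TangentSpace 𝓘(ℝ, E) (γ t)) (t : ℝ) :
    TangentSpace 𝓘(ℝ, E) (γ t) :=
  coordField (γ t) (deriv (fun τ ↦ components (γ t) (γ τ) (V τ)) t) (γ t)
    + cov (coordField (γ t) (components (γ t) (γ t) (V t))) (γ t) (velocity γ t)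

/-- `γ`, restricted to the nonempty open interval `J`, is a geodesic of the connection `cov`,
parametrized by an affine parameter: it is twice continuously differentiable and `∇_{γ'} γ' = 0`.
(For a smooth connection such a curve is automatically smooth.)
The values of `γ` outside `J` are irrelevant. -/
structure IsGeodesicOn
    (cov : CovariantDerivative 𝓘(ℝ, E) E (fun x : M ↦ TangentSpace 𝓘(ℝ, E) x))
    (γ : ℝ → M) (J : Set ℝ) : Prop where
  isOpen : IsOpen J
  isConnected : IsConnected J
  contMDiffOn : ContMDiffOn 𝓘(ℝ, ℝ) 𝓘(ℝ, E) 2 γ J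
  covAlong_eq_zero : ∀ t ∈ J, covAlong cov γ (velocity γ) t = 0

/-- A geodesic on `J` that is not the restriction of a geodesic on a larger interval. -/
structure IsMaximalGeodesic
    (cov : CovariantDerivative 𝓘(ℝ, E) E (fun x : M ↦ TangentSpace 𝓘(ℝ, E) x))
    (γ : ℝ → M) (J : Set ℝ) : Prop where
  isGeodesicOn : IsGeodesicOn cov γ J
  maximal : ∀ (γ' : ℝ → M) (J' : Set ℝ),
    IsGeodesicOn cov γ' J' → J ⊆ J' → EqOn γ' γ J → J' = J

end Geodesics

section Length

variable {M : Type*} [TopologicalSpace M] [ChartedSpace E M] [IsManifold 𝓘(ℝ, E) ∞ M]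
  [Bundle.RiemannianBundle (fun x : M ↦ TangentSpace 𝓘(ℝ, E) x)]

/-- The curve `r` on the open interval `S` is an arc-length parametrization of the curve `γ` on
`J`: it arises from `γ` by a bijective `C¹` change of parameter `φ : S → J` (of either
orientation), and it has unit speed. (As `r` has unit speed, `φ'` has no zero
when `γ` is differentiable.) -/
structure IsArcLengthParametrization (γ : ℝ → M) (J : Set ℝ) (r : ℝ → M) (S : Set ℝ) : Prop where
  isOpen : IsOpen S
  isConnected : IsConnected S
  exists_reparam : ∃ φ : ℝ → ℝ, ContDiffOn ℝ 1 φ S ∧ BijOn φ S J ∧ EqOn r (γ ∘ φ) S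
  unit_speed : ∀ s ∈ S, ‖velocity (E := E) r s‖ = 1

/-- The length `∫_J ‖γ'(t)‖ dt ∈ [0, ∞]` of the curve `γ` on `J`. -/
def curveLength (γ : ℝ → M) (J : Set ℝ) : ENNReal :=
  ∫⁻ t in J, ‖velocity (E := E) γ t‖ₑ

end Length

end AffineGeodesic

end

/-!
Suppose the part of `γ` to the right of some time has finite length. By completeness `γ` converges
to a point `p` at the right end of `J`. In a chart at `p` the velocity `u` satisfies the geodesic
equation `u' = -Γ(u, u)`, and `|u|` is bounded by a multiple of the speed, so `|u'| ≤ K ‖γ'‖ |u|`.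
By Grönwall's inequality, with arc length as the independent variable, `log |u|` varies by at most
`K` times the length of `γ`. Hence `|u|` is bounded above and away from zero. The lower bound, with
finiteness of the length, bounds `J` above. The upper bound makes `u` Lipschitz, so `u` converges
too, and the solution `(γ, u)` of the geodesic equation extends past the end of `J`, contradicting
maximality. Reversing time handles the other end, so arc length maps `J` onto `ℝ`.
-/

namespace AffineGeodesic

open Filter Module
open scoped NNReal Topology

section Frames

variable {E : Type*} [NormedAddCommGroup E] [NormedSpace ℝ E]
  {M : Type*} [TopologicalSpace M] [ChartedSpace E M] [IsManifold 𝓘(ℝ, E) ∞ M] {p x : M}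

theorem components_eq_continuousLinearMapAt (hx : x ∈ (chartAt E p).source)
    (v : TangentSpace 𝓘(ℝ, E) x) :
    components p x v =
      (trivializationAt E (TangentSpace 𝓘(ℝ, E)) p).continuousLinearMapAt ℝ x v :=
  (congrFun ((trivializationAt E (TangentSpace 𝓘(ℝ, E)) p).coe_linearMapAt_of_mem
    (R := ℝ) hx) v).symm

theorem components_coordField (hx : x ∈ (chartAt E p).source) (w : E) :
    components p x (coordField p w x) = w := by
  rw [components_eq_continuousLinearMapAt hx]
  exact (trivializationAt E (TangentSpace 𝓘(ℝ, E)) p).continuousLinearMapAt_symmL hx w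

theorem coordField_components (hx : x ∈ (chartAt E p).source) (v : TangentSpace 𝓘(ℝ, E) x) :
    coordField p (components p x v) x = v := by
  rw [components_eq_continuousLinearMapAt hx]
  exact (trivializationAt E (TangentSpace 𝓘(ℝ, E)) p).symmL_continuousLinearMapAt hx v

theorem components_add (hx : x ∈ (chartAt E p).source) (v w : TangentSpace 𝓘(ℝ, E) x) :
    components p x (v + w) = components p x v + components p x w := by
  simp only [components_eq_continuousLinearMapAt hx, map_add]

theorem components_smul (hx : x ∈ (chartAt E p).source) (c : ℝ) (v : TangentSpace 𝓘(ℝ, E) x) :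
    components p x (c • v) = c • components p x v := by
  simp only [components_eq_continuousLinearMapAt hx, map_smul]

theorem components_eq_zero_iff (hx : x ∈ (chartAt E p).source) {v : TangentSpace 𝓘(ℝ, E) x} :
    components p x v = 0 ↔ v = 0 := by
  refine ⟨fun h ↦ ?_, fun h ↦ ?_⟩
  · rw [← coordField_components hx v, h]
    exact map_zero _
  · rw [h, components_eq_continuousLinearMapAt hx, map_zero]

theorem mdifferentiableAt_components_iff (hx : x ∈ (chartAt E p).source)
    {σ : (y : M) → TangentSpace 𝓘(ℝ, E) y} :
    MDiffAt (fun y ↦ components p y (σ y)) x ↔ MDiffAt (T% σ) x :=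
  ((trivializationAt E (TangentSpace 𝓘(ℝ, E)) p).mdifferentiableAt_section_iff
    𝓘(ℝ, E) σ hx).symm

theorem contMDiffOn_coordField (p : M) (w : E) :
    ContMDiffOn 𝓘(ℝ, E) (𝓘(ℝ, E).prod 𝓘(ℝ, E)) ∞ (T% (coordField p w))
      (chartAt E p).source := by
  rw [(trivializationAt E (TangentSpace 𝓘(ℝ, E)) p).contMDiffOn_section_iff
    (chartAt E p).open_source (by exact subset_rfl)]
  exact (contMDiffOn_const (c := w)).congr fun y hy ↦ components_coordField hy w

theorem mdifferentiableAt_coordField (hx : x ∈ (chartAt E p).source) (w : E) :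
    MDiffAt (T% (coordField p w)) x :=
  ((contMDiffOn_coordField p w).contMDiffAt
    ((chartAt E p).open_source.mem_nhds hx)).mdifferentiableAt (by simp)

theorem mdifferentiableAt_sum_section {ι : Type*} (t : Finset ι)
    (σ : ι → (x : M) → TangentSpace 𝓘(ℝ, E) x) (hσ : ∀ i, MDiffAt (T% (σ i)) x) :
    MDiffAt (T% (∑ i ∈ t, σ i)) x := by
  convert MDifferentiableAt.sum_section (s := t) (fun i _ ↦ hσ i) using 3
  simp

theorem coordField_eq_sum {ι : Type*} [Fintype ι] (b : Basis ι ℝ E) (p : M) (w : E) (x : M) :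
    coordField p w x = ∑ i, b.repr w i • coordField p (b i) x := by
  conv_lhs => rw [← b.sum_repr w]
  exact (map_sum ((trivializationAt E (TangentSpace 𝓘(ℝ, E)) p).symmL ℝ x) _ _).trans
    (Finset.sum_congr rfl fun i _ ↦ map_smul _ _ _)

theorem contDiff_sum_smulRight {ι F : Type*} [Fintype ι] [NormedAddCommGroup F] [NormedSpace ℝ F]
    {n : WithTop ℕ∞} (c : ι → StrongDual ℝ E) :
    ContDiff ℝ n fun A : ι → F ↦ ∑ i, (c i).smulRight (A i) :=
  ContDiff.sum fun i _ ↦ contDiff_const.smulRight (contDiff_apply ℝ F i)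

end Frames

section Christoffel

variable {E : Type*} [NormedAddCommGroup E] [NormedSpace ℝ E]
  {M : Type*} [TopologicalSpace M] [ChartedSpace E M] [IsManifold 𝓘(ℝ, E) ∞ M]
  (cov : CovariantDerivative 𝓘(ℝ, E) E (fun x : M ↦ TangentSpace 𝓘(ℝ, E) x)) {p x : M}

theorem cov_sum {ι : Type*} (t : Finset ι) (σ : ι → (x : M) → TangentSpace 𝓘(ℝ, E) x)
    (hσ : ∀ i, MDiffAt (T% (σ i)) x) :
    cov (∑ i ∈ t, σ i) x = ∑ i ∈ t, cov (σ i) x := by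
  classical
  induction t using Finset.induction_on with
  | empty => simp
  | insert a t ha ih =>
    rw [Finset.sum_insert ha, Finset.sum_insert ha,
      cov.isCovariantDerivativeOnUniv.add (hσ a) (mdifferentiableAt_sum_section t σ hσ), ih]

theorem components_cov_smul_coordField (hx : x ∈ (chartAt E p).source) {f : M → ℝ}
    (hf : MDiffAt f x) (e : E) (v : TangentSpace 𝓘(ℝ, E) x) :
    components p x (cov (f • coordField p e) x v) =
      d% f x v • e + f x • components p x (cov (coordField p e) x v) := by
  rw [cov.isCovariantDerivativeOnUniv.leibniz (mdifferentiableAt_coordField hx e) hf, add_comm]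
  refine (components_add hx _ _).trans ?_
  congr 1
  · refine (components_smul hx _ _).trans ?_
    rw [components_coordField hx]
    rfl
  · exact components_smul hx _ _

variable [FiniteDimensional ℝ E]

/-- The Christoffel symbols of `cov` in the preferred chart at `p`, as the bilinear map
`christoffel cov p x w v = ∑ wⁱ vʲ Γᵢⱼ(x)`, where `Γᵢⱼ ∈ E` are the components of `∇_{∂ⱼ} ∂ᵢ`. -/
noncomputable def christoffel (p x : M) : E →L[ℝ] E →L[ℝ] E :=
  ∑ i, ((finBasis ℝ E).coord i).toContinuousLinearMap.smulRight
    (ContinuousLinearMap.inCoordinates E (TangentSpace 𝓘(ℝ, E)) E (TangentSpace 𝓘(ℝ, E)) p x p x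
      (cov (coordField p (finBasis ℝ E i)) x))

theorem christoffel_components (hx : x ∈ (chartAt E p).source) (w : E)
    (v : TangentSpace 𝓘(ℝ, E) x) :
    christoffel cov p x w (components p x v) = ∑ i, (finBasis ℝ E).repr w i •
      components p x (cov (coordField p (finBasis ℝ E i)) x v) := by
  have hv : (trivializationAt E (TangentSpace 𝓘(ℝ, E)) p).symmL ℝ x (components p x v) = v :=
    coordField_components hx v
  simp only [christoffel, _root_.sum_apply, ContinuousLinearMap.smulRight_apply,
    _root_.smul_apply, components_eq_continuousLinearMapAt hx (cov _ x v)]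
  refine Finset.sum_congr rfl fun i _ ↦ ?_
  simp only [ContinuousLinearMap.inCoordinates, ContinuousLinearMap.comp_apply, hv]
  rfl

theorem components_cov (hx : x ∈ (chartAt E p).source) {σ : (y : M) → TangentSpace 𝓘(ℝ, E) y}
    (hσ : MDiffAt (T% σ) x) (v : TangentSpace 𝓘(ℝ, E) x) :
    components p x (cov σ x v) = d% (fun y ↦ components p y (σ y)) x v +
      christoffel cov p x (components p x (σ x)) (components p x v) := by
  set b := finBasis ℝ E
  set s : M → E := fun y ↦ components p y (σ y)
  have hs : MDiffAt s x := (mdifferentiableAt_components_iff hx).2 hσ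
  let l (i) : E →L[ℝ] ℝ := (b.coord i).toContinuousLinearMap
  let f (i) : M → ℝ := fun y ↦ b.repr (s y) i
  have hf (i) : HasMFDerivAt% (f i) x ((l i).comp (d% s x)) :=
    (l i).hasMFDerivAt.comp x hs.hasMFDerivAt
  have hexpand : ∀ᶠ y in 𝓝 x, σ y = (∑ i, f i • coordField p (b i)) y := by
    filter_upwards [(chartAt E p).open_source.mem_nhds hx] with y hy
    rw [Finset.sum_apply]
    exact (coordField_components hy (σ y)).symm.trans (coordField_eq_sum b p (s y) y)
  have hterm (i) : MDiffAt (T% (f i • coordField p (b i))) x :=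
    (hf i).mdifferentiableAt.smul_section (mdifferentiableAt_coordField hx (b i))
  have hcov : cov σ x = ∑ i, cov (f i • coordField p (b i)) x := by
    rw [← cov_sum cov _ _ hterm]
    exact cov.isCovariantDerivativeOnUniv.congr_of_eventuallyEq hσ
      (mdifferentiableAt_sum_section _ _ hterm) univ_mem hexpand
  have hd : d% s x v = ∑ i, d% (f i) x v • b i := by
    refine (b.sum_repr (d% s x v)).symm.trans (Finset.sum_congr rfl fun i _ ↦ ?_)
    exact congrArg (fun A : E →L[ℝ] ℝ ↦ A v • b i) (hf i).mfderiv.symm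
  rw [hcov, hd, christoffel_components cov hx, ← Finset.sum_add_distrib, _root_.sum_apply,
    components_eq_continuousLinearMapAt hx, map_sum]
  refine Finset.sum_congr rfl fun i _ ↦ ?_
  rw [← components_eq_continuousLinearMapAt hx]
  exact components_cov_smul_coordField cov hx (hf i).mdifferentiableAt (b i) v

variable [T2Space M] {k : ℕ∞} [cov.ContMDiffCovariantDerivative k]

theorem contMDiffAt_inCoordinates_cov_coordField (hx : x ∈ (chartAt E p).source) (w : E) :
    ContMDiffAt 𝓘(ℝ, E) 𝓘(ℝ, E →L[ℝ] E) k
      (fun y ↦ ContinuousLinearMap.inCoordinates E (TangentSpace 𝓘(ℝ, E)) E (TangentSpace 𝓘(ℝ, E))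
        p y p y (cov (coordField p w) y)) x := by
  obtain ⟨ψ, -, hψ⟩ := (SmoothBumpFunction.nhds_basis_tsupport (I := 𝓘(ℝ, E)) x).mem_iff.1
    ((chartAt E p).open_source.mem_nhds hx)
  have hσ : CMDiff ∞ (T% ((ψ : M → ℝ) • coordField p w)) :=
    ψ.contMDiff.contMDiffOn.smul_section_of_tsupport (chartAt E p).open_source hψ
      (contMDiffOn_coordField p w)
  have hcov := (CovariantDerivative.ContMDiffCovariantDerivative.contMDiff (cov := cov)
    (k := k)).contMDiff (hσ.of_le (by exact_mod_cast le_top)).contMDiffOn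
  have hcoord := ((trivializationAt (E →L[ℝ] E)
    (fun y ↦ TangentSpace 𝓘(ℝ, E) y →L[ℝ] TangentSpace 𝓘(ℝ, E) y) p).contMDiffAt_section_iff
      (by simpa using hx)).1 (hcov.contMDiffAt univ_mem)
  refine hcoord.congr_of_eventuallyEq ?_
  filter_upwards [ψ.eventuallyEq_one.eventually_nhds, (chartAt E p).open_source.mem_nhds hx]
    with y hψy hy
  have hloc : cov (coordField p w) y = cov ((ψ : M → ℝ) • coordField p w) y := by
    refine cov.isCovariantDerivativeOnUniv.congr_of_eventuallyEq
      (mdifferentiableAt_coordField hy w) ((hσ y).mdifferentiableAt (by simp)) univ_mem ?_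
    filter_upwards [hψy] with z hz
    simp [hz]
  rw [hloc]
  rfl

theorem contMDiffAt_christoffel (hx : x ∈ (chartAt E p).source) :
    ContMDiffAt 𝓘(ℝ, E) 𝓘(ℝ, E →L[ℝ] E →L[ℝ] E) k (christoffel cov p) x :=
  (contDiff_sum_smulRight fun i ↦ ((finBasis ℝ E).coord i).toContinuousLinearMap).contMDiff
    |>.contMDiffAt.comp x (contMDiffAt_pi_space.2 fun _ ↦
      contMDiffAt_inCoordinates_cov_coordField cov hx _)

end Christoffel

section Curves

variable {E : Type*} [NormedAddCommGroup E] [NormedSpace ℝ E]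
  {M : Type*} [TopologicalSpace M] [ChartedSpace E M] {γ γ' : ℝ → M} {t : ℝ}

theorem hasDerivAt_comp_velocity {F : Type*} [NormedAddCommGroup F] [NormedSpace ℝ F] {f : M → F}
    (hf : MDiffAt f (γ t)) (hγ : MDiffAt γ t) :
    HasDerivAt (f ∘ γ) (d% f (γ t) (velocity γ t)) t := by
  let A : ℝ →L[ℝ] F := (mfderiv% f (γ t)).comp (mfderiv% γ t)
  have hA : HasFDerivAt (f ∘ γ) A t := (hf.hasMFDerivAt.comp t hγ.hasMFDerivAt).hasFDerivAt
  exact hA.hasDerivAt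

theorem velocity_congr (h : γ' =ᶠ[𝓝 t] γ) :
    (velocity (E := E) γ' t : E) = velocity (E := E) γ t :=
  congrArg (fun A : ℝ →L[ℝ] E ↦ A 1) h.mfderiv_eq

variable [IsManifold 𝓘(ℝ, E) ∞ M] {p : M}

/-- The velocity of a curve, in components with respect to the preferred chart at `p`. -/
noncomputable def chartVelocity (p : M) (γ : ℝ → M) (t : ℝ) : E :=
  components p (γ t) (velocity γ t)

theorem hasDerivAt_extChartAt_comp (ht : γ t ∈ (chartAt E p).source) (hγ : MDiffAt γ t) :
    HasDerivAt (fun τ ↦ extChartAt 𝓘(ℝ, E) p (γ τ)) (chartVelocity p γ t) t := by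
  rw [chartVelocity, components_eq_continuousLinearMapAt ht,
    TangentBundle.continuousLinearMapAt_trivializationAt ht]
  exact hasDerivAt_comp_velocity (mdifferentiableAt_extChartAt ht) hγ

theorem contDiffAt_chartVelocity (ht : γ t ∈ (chartAt E p).source) {m : ℕ} {n : WithTop ℕ∞}
    (hmn : m + 1 ≤ n) (hγ : ContMDiffAt 𝓘(ℝ, ℝ) 𝓘(ℝ, E) n γ t) :
    ContDiffAt ℝ m (chartVelocity (E := E) p γ) t := by
  replace hγ := hγ.of_le hmn
  have hcoord : ContDiffAt ℝ (m + 1) (fun τ ↦ extChartAt 𝓘(ℝ, E) p (γ τ)) t :=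
    (((contMDiffAt_extChartAt' (n := ∞) ht).of_le (by exact_mod_cast le_top)).comp t hγ).contDiffAt
  refine ((hcoord.fderiv_right le_rfl).clm_apply (contDiffAt_const (c := 1))).congr_of_eventuallyEq
    ?_
  filter_upwards [hγ.continuousAt ((chartAt E p).open_source.mem_nhds ht),
    (contMDiffAt_iff_contMDiffAt_nhds (n := 1) (by simp)).1 (hγ.of_le le_add_self)] with τ hτ hγτ
  exact (hasDerivAt_extChartAt_comp hτ (hγτ.mdifferentiableAt one_ne_zero)).deriv.symm

theorem hasDerivAt_components_of_components {q : M} (hq : γ t ∈ (chartAt E q).source)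
    (hp : γ t ∈ (chartAt E p).source) (hγ : MDiffAt γ t)
    {V : (τ : ℝ) → TangentSpace 𝓘(ℝ, E) (γ τ)} {W : E}
    (hV : HasDerivAt (fun τ ↦ components q (γ τ) (V τ)) W t) :
    HasDerivAt (fun τ ↦ components p (γ τ) (V τ))
      (d% (fun y ↦ components p y (coordField q (components q (γ t) (V t)) y)) (γ t) (velocity γ t)
        + components p (γ t) (coordField q W (γ t))) t := by
  let T : M → E →L[ℝ] E := fun y ↦ ((trivializationAt E (TangentSpace 𝓘(ℝ, E)) q).coordChangeL ℝ
    (trivializationAt E (TangentSpace 𝓘(ℝ, E)) p) y : E →L[ℝ] E)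
  have hT : MDiffAt T (γ t) := mdifferentiableAt_coordChangeL hq hp
  have hTγ := hasDerivAt_comp_velocity hT hγ
  have hT_apply : ∀ᶠ y in 𝓝 (γ t), ∀ w, components p y (coordField q w y) = T y w := by
    filter_upwards [(chartAt E q).open_source.mem_nhds hq, (chartAt E p).open_source.mem_nhds hp]
      with y hyq hyp w
    rw [coordField, Bundle.Trivialization.symmL_apply _ hyq]
    exact ((trivializationAt E (TangentSpace 𝓘(ℝ, E)) q).coordChangeL_apply
      (trivializationAt E (TangentSpace 𝓘(ℝ, E)) p) ⟨hyq, hyp⟩ w).symm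
  have hfield (w : E) : d% (fun y ↦ components p y (coordField q w y)) (γ t) (velocity γ t) =
      d% T (γ t) (velocity γ t) w := by
    have h := (hasDerivAt_comp_velocity (mdifferentiableAt_components_iff hp |>.2
      (mdifferentiableAt_coordField hq w)) hγ)
    refine h.unique ?_
    have hw := hTγ.clm_apply (hasDerivAt_const t w)
    simp only [map_zero, add_zero] at hw
    exact hw.congr_of_eventuallyEq (hγ.continuousAt.eventually (hT_apply.mono fun y hy ↦ hy w))
  rw [hfield, hT_apply.self_of_nhds]
  refine (hTγ.clm_apply hV).congr_of_eventuallyEq ?_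
  filter_upwards [hγ.continuousAt.eventually hT_apply,
    hγ.continuousAt ((chartAt E q).open_source.mem_nhds hq)] with τ hτ hτq
  rw [Function.comp_apply, ← hτ, coordField_components hτq]

end Curves

section GeodesicEquation

variable {E : Type*} [NormedAddCommGroup E] [NormedSpace ℝ E]
  {M : Type*} [TopologicalSpace M] [ChartedSpace E M] [IsManifold 𝓘(ℝ, E) ∞ M]
  (cov : CovariantDerivative 𝓘(ℝ, E) E (fun x : M ↦ TangentSpace 𝓘(ℝ, E) x))
  {p : M} {γ : ℝ → M} {t : ℝ}

theorem covAlong_velocity_congr {γ' : ℝ → M} (h : γ' =ᶠ[𝓝 t] γ) :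
    (covAlong cov γ' (velocity γ') t : E) = covAlong cov γ (velocity γ) t := by
  let c : M → M → E → E := fun p x v ↦ components p x v
  let f : M → E → E → E → E := fun q e w v ↦ coordField q e q + cov (coordField q w) q v
  have hf (γ : ℝ → M) : (covAlong cov γ (velocity γ) t : E) =
      f (γ t) (deriv (fun τ ↦ c (γ t) (γ τ) (velocity (E := E) γ τ)) t)
        (c (γ t) (γ t) (velocity (E := E) γ t)) (velocity (E := E) γ t) := rfl
  have hc : (fun τ ↦ c (γ t) (γ' τ) (velocity (E := E) γ' τ)) =ᶠ[𝓝 t]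
      fun τ ↦ c (γ t) (γ τ) (velocity (E := E) γ τ) := by
    filter_upwards [h.eventuallyEq_nhds] with τ hτ
    rw [hτ.eq_of_nhds, velocity_congr hτ]
  rw [hf, hf, h.eq_of_nhds, hc.deriv_eq, velocity_congr h]

variable [FiniteDimensional ℝ E]

theorem components_covAlong (ht : γ t ∈ (chartAt E p).source) (hγ : MDiffAt γ t)
    {V : (τ : ℝ) → TangentSpace 𝓘(ℝ, E) (γ τ)}
    (hV : DifferentiableAt ℝ (fun τ ↦ components (γ t) (γ τ) (V τ)) t) :
    components p (γ t) (covAlong cov γ V t) =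
      deriv (fun τ ↦ components p (γ τ) (V τ)) t +
        christoffel cov p (γ t) (components p (γ t) (V t)) (chartVelocity p γ t) := by
  have hq := mem_chart_source E (γ t)
  rw [covAlong, components_add ht, components_cov cov ht (mdifferentiableAt_coordField hq _),
    (hasDerivAt_components_of_components hq ht hγ hV.hasDerivAt).deriv,
    coordField_components hq, chartVelocity]
  abel

theorem covAlong_velocity_eq_zero_iff (ht : γ t ∈ (chartAt E p).source)
    (hγ : ContMDiffAt 𝓘(ℝ, ℝ) 𝓘(ℝ, E) 2 γ t) :
    covAlong cov γ (velocity γ) t = 0 ↔ HasDerivAt (chartVelocity p γ)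
      (-christoffel cov p (γ t) (chartVelocity p γ t) (chartVelocity p γ t)) t := by
  have hu {q : M} (hq : γ t ∈ (chartAt E q).source) : DifferentiableAt ℝ (chartVelocity q γ) t :=
    (contDiffAt_chartVelocity (m := 1) hq (by norm_num [one_add_one_eq_two]) hγ).differentiableAt
      (by simp)
  rw [← components_eq_zero_iff ht, components_covAlong cov ht (hγ.mdifferentiableAt (by simp))
    (hu (mem_chart_source E (γ t))), add_eq_zero_iff_eq_neg]
  exact ⟨fun h ↦ h ▸ (hu ht).hasDerivAt, fun h ↦ h.deriv⟩

variable [T2Space M] {k : ℕ∞} [cov.ContMDiffCovariantDerivative k]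

/-- The geodesic equation in the preferred chart at `p`, as a vector field on `E × E`. -/
noncomputable def geodesicField (p : M) (z : E × E) : E × E :=
  (z.2, -christoffel cov p ((extChartAt 𝓘(ℝ, E) p).symm z.1) z.2 z.2)

theorem contDiffAt_geodesicField {z : E × E} (hz : z.1 ∈ (extChartAt 𝓘(ℝ, E) p).target) :
    ContDiffAt ℝ k (geodesicField cov p) z := by
  have hx : (extChartAt 𝓘(ℝ, E) p).symm z.1 ∈ (chartAt E p).source := by
    simpa using (extChartAt 𝓘(ℝ, E) p).map_target hz
  have hsymm : ContMDiffAt 𝓘(ℝ, E) 𝓘(ℝ, E) k (extChartAt 𝓘(ℝ, E) p).symm z.1 :=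
    ((contMDiffOn_extChartAt_symm (n := ∞) p).contMDiffAt
      ((isOpen_extChartAt_target p).mem_nhds hz)).of_le (by exact_mod_cast le_top)
  have hchristoffel : ContDiffAt ℝ k
      (fun z : E × E ↦ christoffel cov p ((extChartAt 𝓘(ℝ, E) p).symm z.1)) z :=
    ((contMDiffAt_christoffel cov hx).comp z.1 hsymm).contDiffAt.comp z contDiffAt_fst
  exact contDiffAt_snd.prodMk
    ((hchristoffel.clm_apply contDiffAt_snd).clm_apply contDiffAt_snd).neg

end GeodesicEquation

section Gronwall

variable {V : Type*} [NormedAddCommGroup V] [NormedSpace ℝ V] {w w' : ℝ → V} {L l : ℝ → ℝ}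

theorem hasDerivAt_comp_neg {v : V} {t : ℝ} (h : HasDerivAt w v (-t)) :
    HasDerivAt (fun τ ↦ w (-τ)) (-v) t :=
  (h.scomp t (hasDerivAt_neg t)).congr_deriv (neg_one_smul ℝ v)

theorem norm_le_mul_exp_sub_of_norm_deriv_le {s t : ℝ} (hst : s ≤ t)
    (hw : ∀ τ ∈ Icc s t, HasDerivAt w (w' τ) τ) (hL : ∀ τ ∈ Icc s t, HasDerivAt L (l τ) τ)
    (hwl : ∀ τ ∈ Icc s t, ‖w' τ‖ ≤ l τ * ‖w τ‖) :
    ‖w t‖ ≤ ‖w s‖ * Real.exp (L t - L s) := by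
  have hε (ε : ℝ) (hε : 0 < ε) :
      ‖w t‖ ≤ (‖w s‖ + ε) * Real.exp (L t - L s + ε * (t - s)) := by
    let B : ℝ → ℝ := fun τ ↦ (‖w s‖ + ε) * Real.exp (L τ - L s + ε * (τ - s))
    have hB_pos (τ : ℝ) : 0 < B τ := by positivity
    have hB (τ : ℝ) (hτ : τ ∈ Icc s t) : HasDerivAt B ((l τ + ε) * B τ) τ := by
      have hexponent : HasDerivAt (fun τ ↦ L τ - L s + ε * (τ - s)) (l τ + ε) τ := by
        simpa using ((hL τ hτ).sub_const (L s)).fun_add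
          (((hasDerivAt_id' τ).sub_const s).const_mul ε)
      exact (hexponent.exp.const_mul _).congr_deriv (by simp only [B]; ring)
    refine image_norm_le_of_norm_deriv_right_lt_deriv_boundary'
      (fun τ hτ ↦ (hw τ hτ).continuousAt.continuousWithinAt)
      (fun τ hτ ↦ (hw τ (Ico_subset_Icc_self hτ)).hasDerivWithinAt) (B := B)
      (by simpa [B] using hε.le) (fun τ hτ ↦ (hB τ hτ).continuousAt.continuousWithinAt)
      (fun τ hτ ↦ (hB τ (Ico_subset_Icc_self hτ)).hasDerivWithinAt) (fun τ hτ heq ↦ ?_)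
      (right_mem_Icc.2 hst)
    refine (hwl τ (Ico_subset_Icc_self hτ)).trans_lt ?_
    rw [heq]
    exact mul_lt_mul_of_pos_right (lt_add_of_pos_right _ hε) (hB_pos τ)
  have hlim : Tendsto (fun ε ↦ (‖w s‖ + ε) * Real.exp (L t - L s + ε * (t - s))) (𝓝[>] 0)
      (𝓝 (‖w s‖ * Real.exp (L t - L s))) :=
    tendsto_nhdsWithin_of_tendsto_nhds (Continuous.tendsto' (by fun_prop) _ _ (by simp))
  exact ge_of_tendsto hlim (eventually_nhdsWithin_of_forall hε)

theorem norm_le_mul_exp_abs_sub_of_norm_deriv_le {I : Set ℝ} (hI : I.OrdConnected)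
    (hw : ∀ τ ∈ I, HasDerivAt w (w' τ) τ) (hL : ∀ τ ∈ I, HasDerivAt L (l τ) τ)
    (hwl : ∀ τ ∈ I, ‖w' τ‖ ≤ l τ * ‖w τ‖) {s t : ℝ} (hs : s ∈ I) (ht : t ∈ I) :
    ‖w t‖ ≤ ‖w s‖ * Real.exp |L t - L s| := by
  rcases le_total s t with hst | hts
  · have hsub := hI.out hs ht
    refine (norm_le_mul_exp_sub_of_norm_deriv_le hst (fun τ hτ ↦ hw τ (hsub hτ))
      (fun τ hτ ↦ hL τ (hsub hτ)) (fun τ hτ ↦ hwl τ (hsub hτ))).trans ?_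
    gcongr
    exact le_abs_self _
  · have hsub (τ : ℝ) (hτ : τ ∈ Icc (-s) (-t)) : -τ ∈ I :=
      hI.out ht hs ⟨le_neg_of_le_neg hτ.2, neg_le_of_neg_le hτ.1⟩
    have h := norm_le_mul_exp_sub_of_norm_deriv_le (w := fun τ ↦ w (-τ)) (w' := fun τ ↦ -w' (-τ))
      (L := fun τ ↦ -L (-τ)) (l := fun τ ↦ l (-τ)) (neg_le_neg hts)
      (fun τ hτ ↦ hasDerivAt_comp_neg (hw (-τ) (hsub τ hτ)))
      (fun τ hτ ↦ by simpa using (hasDerivAt_comp_neg (hL (-τ) (hsub τ hτ))).fun_neg)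
      (fun τ hτ ↦ by simpa using hwl (-τ) (hsub τ hτ))
    simp only [neg_neg, sub_neg_eq_add, neg_add_eq_sub] at h
    refine h.trans ?_
    rw [abs_sub_comm]
    gcongr
    exact le_abs_self _

end Gronwall

section OrdinaryDifferentialEquations

variable {V : Type*} [NormedAddCommGroup V] [NormedSpace ℝ V] {F : V → V} {z : ℝ → V}

theorem exists_tendsto_nhdsLT_of_norm_deriv_le [CompleteSpace V] {w w' : ℝ → V} {a T C : ℝ}
    (haT : a < T) (hw : ∀ t ∈ Ioo a T, HasDerivAt w (w' t) t) (hC : ∀ t ∈ Ioo a T, ‖w' t‖ ≤ C) :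
    ∃ v, Tendsto w (𝓝[<] T) (𝓝 v) := by
  have hlip := (convex_Ioo a T).lipschitzOnWith_of_nnnorm_hasDerivWithin_le (C := C.toNNReal)
    (fun t ht ↦ (hw t ht).hasDerivWithinAt) fun t ht ↦
      NNReal.coe_le_coe.1 ((hC t ht).trans (Real.le_coe_toNNReal C))
  have hcauchy : Cauchy (𝓝[<] T) := cauchy_nhds.mono' inferInstance nhdsWithin_le_nhds
  exact CompleteSpace.complete (hcauchy.map_of_le hlip.uniformContinuousOn
    (le_principal_iff.2 (Ioo_mem_nhdsLT haT)))

theorem hasDerivWithinAt_Iic_of_hasDerivAt_Ioo {a T : ℝ} (haT : a < T)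
    (hz : ∀ t ∈ Ioo a T, HasDerivAt z (F (z t)) t) (hzT : ContinuousWithinAt z (Iio T) T)
    (hF : ContinuousAt F (z T)) : HasDerivWithinAt z (F (z T)) (Iic T) T := by
  have hIoo : Ioo a T ∈ 𝓝[<] T := Ioo_mem_nhdsLT haT
  refine hasDerivWithinAt_Iic_of_tendsto_deriv (s := Ioo a T)
    (fun t ht ↦ (hz t ht).differentiableAt.differentiableWithinAt)
    (hzT.mono Ioo_subset_Iio_self) hIoo ?_
  refine (hF.tendsto.comp hzT).congr' ?_
  filter_upwards [hIoo] with t ht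
  exact (hz t ht).deriv.symm

theorem exists_ode_extension [CompleteSpace V] {z₀ : V} (hF : ContDiffAt ℝ 1 F z₀) {a T : ℝ}
    (haT : a < T) (hz : ∀ t ∈ Ioo a T, HasDerivAt z (F (z t)) t)
    (hlim : Tendsto z (𝓝[<] T) (𝓝 z₀)) :
    ∃ Z : ℝ → V, ∃ ε > 0, EqOn Z z (Iio T) ∧ Z T = z₀ ∧
      ∀ t ∈ Ioo a (T + ε), HasDerivAt Z (F (Z t)) t := by
  obtain ⟨α, hα_T, ε, hε, hα⟩ :=
    hF.exists_forall_mem_closedBall_exists_eq_forall_mem_Ioo_hasDerivAt₀ T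
  classical
  let Z : ℝ → V := fun t ↦ if t < T then z t else α t
  have hZz : EqOn Z z (Iio T) := fun t ht ↦ if_pos ht
  have hZα : EqOn Z α (Ici T) := fun t ht ↦ if_neg (not_lt.2 ht)
  have hZT : Z T = z₀ := (hZα self_mem_Ici).trans hα_T
  have hleft (t) (ht : t ∈ Ioo a T) : HasDerivAt Z (F (Z t)) t := by
    rw [hZz ht.2]
    exact (hz t ht).congr_of_eventuallyEq (eventuallyEq_of_mem (Iio_mem_nhds ht.2) hZz)
  refine ⟨Z, ε, hε, hZz, hZT, fun t ht ↦ ?_⟩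
  rcases lt_trichotomy t T with htT | rfl | hTt
  · exact hleft t ⟨ht.1, htT⟩
  · have hZ_lim : ContinuousWithinAt Z (Iio t) t := by
      rw [ContinuousWithinAt, hZT]
      exact hlim.congr' (eventuallyEq_of_mem self_mem_nhdsWithin hZz.symm)
    have hIic := hasDerivWithinAt_Iic_of_hasDerivAt_Ioo haT hleft hZ_lim
      (hZT ▸ hF.continuousAt)
    have hIci : HasDerivWithinAt Z (F (Z t)) (Ici t) t := by
      rw [hZα self_mem_Ici]
      exact (hα t ⟨by linarith, by linarith⟩).hasDerivWithinAt.congr hZα (hZα self_mem_Ici)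
    simpa only [Iic_union_Ici, hasDerivWithinAt_univ] using hIic.union hIci
  · rw [hZα hTt.le]
    exact (hα t ⟨by linarith, ht.2⟩).congr_of_eventuallyEq
      (eventuallyEq_of_mem (Ioi_mem_nhds hTt) (hZα.mono Ioi_subset_Ici_self))

theorem contDiffOn_two_of_hasDerivAt {O : Set ℝ} (hO : IsOpen O)
    (hF : ∀ t ∈ O, ContDiffAt ℝ 1 F (z t)) (hz : ∀ t ∈ O, HasDerivAt z (F (z t)) t) :
    ContDiffOn ℝ 2 z O := by
  have hderiv : EqOn (deriv z) (F ∘ z) O := fun t ht ↦ (hz t ht).deriv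
  have hdiff : DifferentiableOn ℝ z O := fun t ht ↦
    (hz t ht).differentiableAt.differentiableWithinAt
  have hone : ContDiffOn ℝ 1 z O := by
    rw [← zero_add 1, contDiffOn_succ_iff_deriv_of_isOpen hO, contDiffOn_zero]
    exact ⟨hdiff, by simp, .congr (fun t ht ↦
      ((hF t ht).continuousAt.comp (hz t ht).continuousAt).continuousWithinAt) hderiv⟩
  rw [← one_add_one_eq_two, contDiffOn_succ_iff_deriv_of_isOpen hO]
  exact ⟨hdiff, by simp, .congr (fun t ht ↦ (hF t ht).comp_contDiffWithinAt t (hone t ht)) hderiv⟩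

end OrdinaryDifferentialEquations

section Intervals

variable {J : Set ℝ} {T : ℝ}

theorem subset_Iio_of_isLUB (hJ : IsOpen J) (hT : IsLUB J T) : J ⊆ Iio T :=
  (interior_maximal (fun _ ht ↦ hT.1 ht) hJ).trans interior_Iic.subset

theorem Ioo_subset_of_isLUB (hJ : J.OrdConnected) (hT : IsLUB J T) {a : ℝ} (ha : a ∈ J) :
    Ioo a T ⊆ J := fun _ ht ↦
  let ⟨_, hb, htb⟩ := (lt_isLUB_iff hT).1 ht.2
  hJ.out ha hb ⟨ht.1.le, htb.le⟩

theorem map_coe_atTop_of_isLUB (hJ : IsOpen J) (hJ' : J.OrdConnected) (hT : IsLUB J T) :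
    map ((↑) : J → ℝ) atTop = 𝓝[<] T := by
  have hlt := subset_Iio_of_isLUB hJ hT
  refine map_coe_atTop_of_Ioo_subset hlt fun b hb ↦ ?_
  obtain ⟨a, ha, -⟩ := (lt_isLUB_iff hT).1 hb
  exact ⟨a, hlt ha, Ioo_subset_of_isLUB hJ' hT ha⟩

end Intervals

section Geodesics

variable {E : Type*} [NormedAddCommGroup E] [NormedSpace ℝ E]
  {M : Type*} [TopologicalSpace M] [ChartedSpace E M] [IsManifold 𝓘(ℝ, E) ∞ M]
  {cov : CovariantDerivative 𝓘(ℝ, E) E (fun x : M ↦ TangentSpace 𝓘(ℝ, E) x)}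
  {γ γ' : ℝ → M} {J J' : Set ℝ} {t : ℝ}

namespace IsGeodesicOn

theorem contMDiffAt (h : IsGeodesicOn cov γ J) (ht : t ∈ J) :
    ContMDiffAt 𝓘(ℝ, ℝ) 𝓘(ℝ, E) 2 γ t :=
  h.contMDiffOn.contMDiffAt (h.isOpen.mem_nhds ht)

theorem contMDiffOn_one (h : IsGeodesicOn cov γ J) : ContMDiffOn 𝓘(ℝ, ℝ) 𝓘(ℝ, E) 1 γ J :=
  h.contMDiffOn.of_le one_le_two

theorem mdifferentiableAt (h : IsGeodesicOn cov γ J) (ht : t ∈ J) : MDiffAt γ t :=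
  (h.contMDiffAt ht).mdifferentiableAt two_ne_zero

theorem ordConnected (h : IsGeodesicOn cov γ J) : J.OrdConnected :=
  h.isConnected.isPreconnected.ordConnected

theorem congr (h : IsGeodesicOn cov γ J) (heq : EqOn γ' γ J) : IsGeodesicOn cov γ' J where
  isOpen := h.isOpen
  isConnected := h.isConnected
  contMDiffOn := h.contMDiffOn.congr heq
  covAlong_eq_zero t ht :=
    (covAlong_velocity_congr cov (eventuallyEq_of_mem (h.isOpen.mem_nhds ht) heq)).trans
      (h.covAlong_eq_zero t ht)

theorem union (h : IsGeodesicOn cov γ J) (h' : IsGeodesicOn cov γ J') (hJ : (J ∩ J').Nonempty) :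
    IsGeodesicOn cov γ (J ∪ J') where
  isOpen := h.isOpen.union h'.isOpen
  isConnected := h.isConnected.union hJ h'.isConnected
  contMDiffOn := h.contMDiffOn.union_of_isOpen h'.contMDiffOn h.isOpen h'.isOpen
  covAlong_eq_zero t ht := ht.elim (h.covAlong_eq_zero t) (h'.covAlong_eq_zero t)

variable [FiniteDimensional ℝ E] {p : M}

theorem hasDerivAt_chartVelocity (h : IsGeodesicOn cov γ J) (ht : t ∈ J)
    (hp : γ t ∈ (chartAt E p).source) : HasDerivAt (chartVelocity p γ)
      (-christoffel cov p (γ t) (chartVelocity p γ t) (chartVelocity p γ t)) t :=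
  (covAlong_velocity_eq_zero_iff cov hp (h.contMDiffAt ht)).1 (h.covAlong_eq_zero t ht)

theorem hasDerivAt_geodesicField (h : IsGeodesicOn cov γ J) (ht : t ∈ J)
    (hp : γ t ∈ (chartAt E p).source) :
    HasDerivAt (fun τ ↦ (extChartAt 𝓘(ℝ, E) p (γ τ), chartVelocity p γ τ))
      (geodesicField cov p (extChartAt 𝓘(ℝ, E) p (γ t), chartVelocity p γ t)) t := by
  simp only [geodesicField, extChartAt, OpenPartialHomeomorph.extend_left_inv _ hp]
  exact (hasDerivAt_extChartAt_comp hp (h.mdifferentiableAt ht)).prodMk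
    (h.hasDerivAt_chartVelocity ht hp)

variable [T2Space M] {k : ℕ∞} [cov.ContMDiffCovariantDerivative k]

theorem of_hasDerivAt_geodesicField (hk : 1 ≤ k) {Z : ℝ → E × E} {O : Set ℝ} (hO : IsOpen O)
    (hO' : IsConnected O) (hZ_mem : ∀ t ∈ O, (Z t).1 ∈ (extChartAt 𝓘(ℝ, E) p).target)
    (hZ : ∀ t ∈ O, HasDerivAt Z (geodesicField cov p (Z t)) t) :
    IsGeodesicOn cov (fun t ↦ (extChartAt 𝓘(ℝ, E) p).symm (Z t).1) O := by
  set γ : ℝ → M := fun t ↦ (extChartAt 𝓘(ℝ, E) p).symm (Z t).1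
  have hZ_C2 : ContDiffOn ℝ 2 Z O := contDiffOn_two_of_hasDerivAt hO
    (fun t ht ↦ (contDiffAt_geodesicField cov (k := k) (hZ_mem t ht)).of_le
      (by exact_mod_cast hk)) hZ
  have hγ_C2 (t) (ht : t ∈ O) : ContMDiffAt 𝓘(ℝ, ℝ) 𝓘(ℝ, E) 2 γ t := by
    have hsymm : ContMDiffAt 𝓘(ℝ, E) 𝓘(ℝ, E) 2 (extChartAt 𝓘(ℝ, E) p).symm (Z t).1 :=
      ((contMDiffOn_extChartAt_symm (n := ∞) p).contMDiffAt
        ((isOpen_extChartAt_target p).mem_nhds (hZ_mem t ht))).of_le (by norm_cast)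
    exact hsymm.comp t (contDiffAt_fst.comp t (hZ_C2.contDiffAt (hO.mem_nhds ht))).contMDiffAt
  have hγ_mem (t) (ht : t ∈ O) : γ t ∈ (chartAt E p).source := by
    rw [← extChartAt_source 𝓘(ℝ, E)]
    exact (extChartAt 𝓘(ℝ, E) p).map_target (hZ_mem t ht)
  have hvelocity : EqOn (chartVelocity p γ) (fun t ↦ (Z t).2) O := fun t ht ↦ by
    have hZ₁ : HasDerivAt (fun τ ↦ (Z τ).1) (Z t).2 t := (hZ t ht).fst
    refine (hasDerivAt_extChartAt_comp (hγ_mem t ht)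
      ((hγ_C2 t ht).mdifferentiableAt two_ne_zero)).unique (hZ₁.congr_of_eventuallyEq ?_)
    filter_upwards [hO.mem_nhds ht] with τ hτ using (extChartAt 𝓘(ℝ, E) p).right_inv (hZ_mem τ hτ)
  refine ⟨hO, hO', fun t ht ↦ (hγ_C2 t ht).contMDiffWithinAt, fun t ht ↦ ?_⟩
  rw [covAlong_velocity_eq_zero_iff cov (hγ_mem t ht) (hγ_C2 t ht), hvelocity ht]
  have hZ₂ : HasDerivAt (fun τ ↦ (Z τ).2) (-christoffel cov p (γ t) (Z t).2 (Z t).2) t :=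
    (hZ t ht).snd
  exact hZ₂.congr_of_eventuallyEq (eventuallyEq_of_mem (hO.mem_nhds ht) hvelocity)

theorem exists_extension (hk : 1 ≤ k) (h : IsGeodesicOn cov γ J) {T : ℝ} (hT : J ∈ 𝓝[<] T)
    {u₀ : E} (hγ : Tendsto γ (𝓝[<] T) (𝓝 p))
    (hu : Tendsto (chartVelocity p γ) (𝓝[<] T) (𝓝 u₀)) :
    ∃ γ' : ℝ → M, ∃ b < T, ∃ c > T, IsGeodesicOn cov γ' (Ioo b c) ∧ EqOn γ' γ (Ioo b T) := by
  obtain ⟨a, haT, ha⟩ := (mem_nhdsLT_iff_exists_Ioo_subset (a := T)).1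
    (inter_mem hT (hγ (chart_source_mem_nhds E p)))
  have hlim : Tendsto (fun t ↦ (extChartAt 𝓘(ℝ, E) p (γ t), chartVelocity p γ t)) (𝓝[<] T)
      (𝓝 (extChartAt 𝓘(ℝ, E) p p, u₀)) :=
    ((continuousAt_extChartAt p).tendsto.comp hγ).prodMk_nhds hu
  have hF : ContDiffAt ℝ 1 (geodesicField cov p) (extChartAt 𝓘(ℝ, E) p p, u₀) :=
    (contDiffAt_geodesicField cov (k := k) (mem_extChartAt_target p)).of_le (by exact_mod_cast hk)
  obtain ⟨Z, ε, hε, hZ_eq, hZT, hZ⟩ := exists_ode_extension hF haT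
    (fun t ht ↦ h.hasDerivAt_geodesicField (ha ht).1 (ha ht).2) hlim
  have hmem : ∀ᶠ t in 𝓝 T, (Z t).1 ∈ (extChartAt 𝓘(ℝ, E) p).target ∧ t ∈ Ioo a (T + ε) := by
    have hTmem : T ∈ Ioo a (T + ε) := ⟨haT, by linarith⟩
    refine ((hZ T hTmem).continuousAt.fst.eventually_mem ?_).and (Ioo_mem_nhds hTmem.1 hTmem.2)
    rw [hZT]
    exact (isOpen_extChartAt_target p).mem_nhds (mem_extChartAt_target p)
  obtain ⟨b, c, hTbc, hbc⟩ := mem_nhds_iff_exists_Ioo_subset.1 hmem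
  refine ⟨_, b, hTbc.1, c, hTbc.2, .of_hasDerivAt_geodesicField hk isOpen_Ioo
    (isConnected_Ioo (hTbc.1.trans hTbc.2)) (fun t ht ↦ (hbc ht).1) fun t ht ↦ hZ t (hbc ht).2,
    fun t ht ↦ ?_⟩
  have hta : t ∈ Ioo a T := ⟨(hbc ⟨ht.1, ht.2.trans hTbc.2⟩).2.1, ht.2⟩
  simp only [hZ_eq ht.2]
  exact (chartAt E p).extend_left_inv (ha hta).2

end IsGeodesicOn

theorem IsMaximalGeodesic.not_tendsto_chartVelocity [FiniteDimensional ℝ E] [T2Space M] {k : ℕ∞}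
    [cov.ContMDiffCovariantDerivative k] (hk : 1 ≤ k) (h : IsMaximalGeodesic cov γ J) {T : ℝ}
    (hT : IsLUB J T) {p : M} (hγ : Tendsto γ (𝓝[<] T) (𝓝 p)) (u₀ : E) :
    ¬ Tendsto (chartVelocity p γ) (𝓝[<] T) (𝓝 u₀) := by
  intro hu
  have hg := h.isGeodesicOn
  have hJT : J ⊆ Iio T := subset_Iio_of_isLUB hg.isOpen hT
  obtain ⟨a, ha⟩ := hg.isConnected.nonempty
  have hJ : J ∈ 𝓝[<] T :=
    mem_of_superset (Ioo_mem_nhdsLT (hJT ha)) (Ioo_subset_of_isLUB hg.ordConnected hT ha)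
  obtain ⟨γ₂, b, hbT, c, hTc, hγ₂, hγγ₂⟩ := hg.exists_extension hk hJ hγ hu
  classical
  let γ₁ : ℝ → M := fun t ↦ if t < T then γ t else γ₂ t
  have heq : EqOn γ₁ γ J := fun t ht ↦ if_pos (hJT ht)
  have heq₂ : EqOn γ₁ γ₂ (Ioo b c) := fun t ht ↦
    (lt_or_ge t T).elim (fun htT ↦ (if_pos htT).trans (hγγ₂ ⟨ht.1, htT⟩).symm)
      fun htT ↦ if_neg htT.not_gt
  have hunion : IsGeodesicOn cov γ₁ (J ∪ Ioo b c) := (hg.congr heq).union (hγ₂.congr heq₂)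
    (nonempty_of_mem (inter_mem hJ (mem_nhdsWithin_of_mem_nhds (Ioo_mem_nhds hbT hTc))))
  have hTJ : T ∈ J := h.maximal γ₁ _ hunion subset_union_left heq ▸ .inr ⟨hbT, hTc⟩
  exact lt_irrefl T (hJT hTJ)

end Geodesics

section ArcLength

variable {E : Type*} [NormedAddCommGroup E] [NormedSpace ℝ E]
  {M : Type*} [TopologicalSpace M] [ChartedSpace E M]

theorem velocity_comp {γ : ℝ → M} {f : ℝ → ℝ} {f' s : ℝ} (hγ : MDiffAt γ (f s))
    (hf : HasDerivAt f f' s) :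
    velocity (E := E) (γ ∘ f) s = f' • velocity (E := E) γ (f s) := by
  let A : ℝ →L[ℝ] E := mfderiv% γ (f s)
  have hA : velocity (E := E) (γ ∘ f) s = A (f' • (1 : ℝ)) := by
    rw [velocity, (hγ.hasMFDerivAt.comp s hf.hasFDerivAt.hasMFDerivAt).mfderiv, smul_eq_mul,
      mul_comm]
    rfl
  exact hA.trans (map_smul A f' 1)

theorem velocity_comp_neg (γ : ℝ → M) (t : ℝ) :
    velocity (E := E) (γ ∘ Neg.neg) t = -velocity (E := E) γ (-t) := by
  by_cases hγ : MDiffAt γ (-t)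
  · exact (velocity_comp hγ (hasDerivAt_neg t)).trans (neg_one_smul ℝ _)
  · have hγ' : ¬ MDiffAt (γ ∘ Neg.neg) t := fun h ↦ hγ <| by
      have hneg : MDiffAt (Neg.neg : ℝ → ℝ) (-t) :=
        differentiable_neg.differentiableAt.mdifferentiableAt
      have h' : MDiffAt (γ ∘ Neg.neg) (- -t) := (neg_neg t).symm ▸ h
      simpa only [Function.comp_assoc, neg_comp_neg, Function.comp_id] using h'.comp (-t) hneg
    rw [velocity, velocity, mfderiv_zero_of_not_mdifferentiableAt hγ,
      mfderiv_zero_of_not_mdifferentiableAt hγ']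
    exact neg_zero.symm

variable [Bundle.RiemannianBundle (fun x : M ↦ TangentSpace 𝓘(ℝ, E) x)]

/-- The signed length `∫ ‖γ'‖` of the curve `γ` from the time `t₀` to the time `t`, as a primitive
of the speed of `γ`. -/
noncomputable def arcLength (γ : ℝ → M) (t₀ t : ℝ) : ℝ :=
  ∫ τ in t₀..t, ‖velocity (E := E) γ τ‖

theorem arcLength_self (γ : ℝ → M) (t : ℝ) : arcLength (E := E) γ t t = 0 :=
  intervalIntegral.integral_same

theorem arcLength_comp_neg (γ : ℝ → M) (t₀ t : ℝ) :
    arcLength (E := E) (γ ∘ Neg.neg) (-t₀) t = -arcLength (E := E) γ t₀ (-t) := by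
  have hspeed (τ : ℝ) :
      ‖velocity (E := E) (γ ∘ Neg.neg) τ‖ = ‖velocity (E := E) γ (-τ)‖ := by
    rw [velocity_comp_neg]
    exact norm_neg _
  simp only [arcLength, hspeed]
  rw [intervalIntegral.integral_comp_neg fun τ ↦ ‖velocity (E := E) γ τ‖, neg_neg,
    intervalIntegral.integral_symm]

variable [IsManifold 𝓘(ℝ, E) ∞ M]
  [IsContinuousRiemannianBundle E (fun x : M ↦ TangentSpace 𝓘(ℝ, E) x)]
  {γ : ℝ → M} {J : Set ℝ} {t₀ s t : ℝ}

theorem continuousOn_speed (hJ : IsOpen J) (hγ : ContMDiffOn 𝓘(ℝ, ℝ) 𝓘(ℝ, E) 1 γ J) :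
    ContinuousOn (fun τ ↦ ‖velocity (E := E) γ τ‖) J := fun t ht ↦ by
  have hγt : ContMDiffAt 𝓘(ℝ, ℝ) 𝓘(ℝ, E) 1 γ t := hγ.contMDiffAt (hJ.mem_nhds ht)
  have hv : ContinuousAt
      (fun τ ↦ (⟨γ τ, velocity γ τ⟩ : Bundle.TotalSpace E (TangentSpace 𝓘(ℝ, E) (M := M)))) t := by
    rw [FiberBundle.continuousAt_totalSpace]
    exact ⟨hγt.continuousAt, (contDiffAt_chartVelocity (m := 0) (mem_chart_source E (γ t))
      (by simp) hγt).continuousAt⟩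
  exact ((hv.inner_bundle hv).sqrt.congr
    (.of_forall fun _ ↦ (norm_eq_sqrt_real_inner _).symm)).continuousWithinAt

theorem intervalIntegrable_speed (hJ : IsOpen J) (hJ' : J.OrdConnected)
    (hγ : ContMDiffOn 𝓘(ℝ, ℝ) 𝓘(ℝ, E) 1 γ J) (hs : s ∈ J) (ht : t ∈ J) :
    IntervalIntegrable (fun τ ↦ ‖velocity (E := E) γ τ‖) volume s t :=
  ((continuousOn_speed hJ hγ).mono (hJ'.uIcc_subset hs ht)).intervalIntegrable

theorem hasStrictDerivAt_arcLength (hJ : IsOpen J) (hJ' : J.OrdConnected)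
    (hγ : ContMDiffOn 𝓘(ℝ, ℝ) 𝓘(ℝ, E) 1 γ J) (ht₀ : t₀ ∈ J) (ht : t ∈ J) :
    HasStrictDerivAt (arcLength (E := E) γ t₀) ‖velocity (E := E) γ t‖ t :=
  intervalIntegral.integral_hasStrictDerivAt_right (intervalIntegrable_speed hJ hJ' hγ ht₀ ht)
    ((continuousOn_speed hJ hγ).stronglyMeasurableAtFilter hJ t ht)
    ((continuousOn_speed hJ hγ).continuousAt (hJ.mem_nhds ht))

theorem hasDerivAt_arcLength (hJ : IsOpen J) (hJ' : J.OrdConnected)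
    (hγ : ContMDiffOn 𝓘(ℝ, ℝ) 𝓘(ℝ, E) 1 γ J) (ht₀ : t₀ ∈ J) (ht : t ∈ J) :
    HasDerivAt (arcLength (E := E) γ t₀) ‖velocity (E := E) γ t‖ t :=
  (hasStrictDerivAt_arcLength hJ hJ' hγ ht₀ ht).hasDerivAt

theorem pathELength_eq_ofReal_arcLength_sub (hJ : IsOpen J) (hJ' : J.OrdConnected)
    (hγ : ContMDiffOn 𝓘(ℝ, ℝ) 𝓘(ℝ, E) 1 γ J) (ht₀ : t₀ ∈ J) (hs : s ∈ J) (ht : t ∈ J)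
    (hst : s ≤ t) : Manifold.pathELength 𝓘(ℝ, E) γ s t =
      ENNReal.ofReal (arcLength (E := E) γ t₀ t - arcLength (E := E) γ t₀ s) := by
  rw [arcLength, arcLength, intervalIntegral.integral_interval_sub_left
    (intervalIntegrable_speed hJ hJ' hγ ht₀ ht) (intervalIntegrable_speed hJ hJ' hγ ht₀ hs),
    intervalIntegral.integral_of_le hst, ← integral_Icc_eq_integral_Ioc,
    ofReal_integral_eq_lintegral_ofReal
      ((continuousOn_speed hJ hγ).mono (hJ'.out hs ht)).integrableOn_Icc
      (.of_forall fun _ ↦ norm_nonneg _), Manifold.pathELength_eq_lintegral_mfderiv_Icc]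
  simp only [ofReal_norm]
  rfl

theorem monotoneOn_arcLength (hJ : IsOpen J) (hJ' : J.OrdConnected)
    (hγ : ContMDiffOn 𝓘(ℝ, ℝ) 𝓘(ℝ, E) 1 γ J) (ht₀ : t₀ ∈ J) :
    MonotoneOn (arcLength (E := E) γ t₀) J :=
  monotoneOn_of_hasDerivWithinAt_nonneg hJ'.convex
    (fun _ ht ↦ (hasDerivAt_arcLength hJ hJ' hγ ht₀ ht).continuousAt.continuousWithinAt)
    (fun _ ht ↦ (hasDerivAt_arcLength hJ hJ' hγ ht₀ (interior_subset ht)).hasDerivWithinAt)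
    fun _ _ ↦ norm_nonneg _

theorem ofReal_arcLength_le_curveLength (hJ : IsOpen J) (hJ' : J.OrdConnected)
    (hγ : ContMDiffOn 𝓘(ℝ, ℝ) 𝓘(ℝ, E) 1 γ J) (hs : s ∈ J) (ht : t ∈ J) :
    ENNReal.ofReal (arcLength (E := E) γ s t) ≤ curveLength (E := E) γ J := by
  rcases le_total s t with hst | hts
  · rw [← sub_zero (arcLength (E := E) γ s t), ← arcLength_self (E := E) γ s,
      ← pathELength_eq_ofReal_arcLength_sub hJ hJ' hγ hs hs ht hst,
      Manifold.pathELength_eq_lintegral_mfderiv_Icc]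
    exact lintegral_mono_set (hJ'.out hs ht)
  · rw [ENNReal.ofReal_of_nonpos]
    · exact zero_le
    · exact (monotoneOn_arcLength hJ hJ' hγ hs ht hs hts).trans_eq (arcLength_self γ s)

end ArcLength

section Distance

variable {E : Type*} [NormedAddCommGroup E] [NormedSpace ℝ E]
  {M : Type*} [EMetricSpace M] [ChartedSpace E M] [IsManifold 𝓘(ℝ, E) ∞ M]
  [Bundle.RiemannianBundle (fun x : M ↦ TangentSpace 𝓘(ℝ, E) x)]
  [IsContinuousRiemannianBundle E (fun x : M ↦ TangentSpace 𝓘(ℝ, E) x)]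
  [IsRiemannianManifold 𝓘(ℝ, E) M] {γ : ℝ → M} {J : Set ℝ} {t₀ s t : ℝ}

theorem edist_le_edist_arcLength (hJ : IsOpen J) (hJ' : J.OrdConnected)
    (hγ : ContMDiffOn 𝓘(ℝ, ℝ) 𝓘(ℝ, E) 1 γ J) (ht₀ : t₀ ∈ J) (hs : s ∈ J) (ht : t ∈ J) :
    edist (γ s) (γ t) ≤ edist (arcLength (E := E) γ t₀ s) (arcLength (E := E) γ t₀ t) := by
  wlog hst : s ≤ t generalizing s t
  · rw [edist_comm, edist_comm (arcLength _ _ _)]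
    exact this ht hs (le_of_not_ge hst)
  calc edist (γ s) (γ t)
      ≤ Manifold.pathELength 𝓘(ℝ, E) γ s t := by
        rw [IsRiemannianManifold.out (I := 𝓘(ℝ, E)) (γ s) (γ t)]
        exact Manifold.riemannianEDist_le_pathELength (hγ.mono (hJ'.out hs ht)) rfl rfl hst
    _ = ENNReal.ofReal (arcLength (E := E) γ t₀ t - arcLength (E := E) γ t₀ s) :=
        pathELength_eq_ofReal_arcLength_sub hJ hJ' hγ ht₀ hs ht hst
    _ ≤ edist (arcLength (E := E) γ t₀ s) (arcLength (E := E) γ t₀ t) := by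
        rw [edist_comm, edist_dist, Real.dist_eq]
        exact ENNReal.ofReal_le_ofReal (le_abs_self _)

end Distance

section LocalBounds

variable {E : Type*} [NormedAddCommGroup E] [NormedSpace ℝ E]
  {M : Type*} [TopologicalSpace M] [ChartedSpace E M] [IsManifold 𝓘(ℝ, E) ∞ M]
  [Bundle.RiemannianBundle (fun x : M ↦ TangentSpace 𝓘(ℝ, E) x)]
  [IsContinuousRiemannianBundle E (fun x : M ↦ TangentSpace 𝓘(ℝ, E) x)]

theorem eventually_norm_components_le (p : M) : ∃ D : ℝ≥0, ∀ᶠ x in 𝓝 p,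
    ∀ v : TangentSpace 𝓘(ℝ, E) x, ‖components p x v‖ ≤ D * ‖v‖ := by
  obtain ⟨D, hD, hbound⟩ :=
    eventually_norm_trivializationAt_lt E (fun x : M ↦ TangentSpace 𝓘(ℝ, E) x) p
  lift D to ℝ≥0 using hD.le
  refine ⟨D, ?_⟩
  filter_upwards [hbound, chart_source_mem_nhds E p] with x hxD hx v
  rw [components_eq_continuousLinearMapAt hx]
  exact ContinuousLinearMap.le_of_opNorm_le _ hxD.le v

variable [FiniteDimensional ℝ E]
  {cov : CovariantDerivative 𝓘(ℝ, E) E (fun x : M ↦ TangentSpace 𝓘(ℝ, E) x)}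

variable (cov) in
/-- On `U`, a part of the domain of the preferred chart at `p`, the metric is bounded below and the
Christoffel symbols of `cov` are bounded above, both uniformly in this chart. -/
structure IsControlled (p : M) (D B : ℝ≥0) (U : Set M) : Prop where
  subset_source : U ⊆ (chartAt E p).source
  norm_components_le : ∀ x ∈ U, ∀ v : TangentSpace 𝓘(ℝ, E) x, ‖components p x v‖ ≤ D * ‖v‖
  norm_christoffel_le : ∀ x ∈ U, ‖christoffel cov p x‖ ≤ B

variable (cov) in
theorem exists_isControlled [T2Space M] {k : ℕ∞} [cov.ContMDiffCovariantDerivative k] (p : M) :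
    ∃ U ∈ 𝓝 p, ∃ D B, IsControlled cov p D B U := by
  obtain ⟨D, hD⟩ := eventually_norm_components_le (E := E) p
  have hΓ : ContinuousAt (‖christoffel cov p ·‖) p := ContinuousAt.norm (E := E →L[ℝ] E →L[ℝ] E)
    (contMDiffAt_christoffel (k := k) cov (mem_chart_source E p)).continuousAt
  have hB : ∀ᶠ x in 𝓝 p, ‖christoffel cov p x‖ < ‖christoffel cov p p‖ + 1 :=
    hΓ.eventually_lt continuousAt_const (lt_add_one _)
  exact ⟨_, (hD.and hB).and (chart_source_mem_nhds E p), D, ‖christoffel cov p p‖₊ + 1,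
    fun _ hx ↦ hx.2, fun _ hx ↦ hx.1.1, fun _ hx ↦ hx.1.2.le⟩

namespace IsGeodesicOn

variable {γ : ℝ → M} {J I : Set ℝ} {p : M} {D B : ℝ≥0} {U : Set M} {a t₀ s t : ℝ}

theorem norm_chartVelocity_le (h : IsGeodesicOn cov γ J) (hU : IsControlled cov p D B U)
    (hI : I.OrdConnected) (hIJ : I ⊆ J) (hγ : MapsTo γ I U) (ht₀ : t₀ ∈ J) (hs : s ∈ I)
    (ht : t ∈ I) : ‖chartVelocity (E := E) p γ t‖ ≤ ‖chartVelocity (E := E) p γ s‖ *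
      Real.exp (B * D * |arcLength (E := E) γ t₀ t - arcLength (E := E) γ t₀ s|) := by
  have hderiv (τ) (hτ : τ ∈ I) :
      ‖-christoffel cov p (γ τ) (chartVelocity p γ τ) (chartVelocity p γ τ)‖ ≤
        B * D * ‖velocity (E := E) γ τ‖ * ‖chartVelocity (E := E) p γ τ‖ :=
    calc _ ≤ ‖christoffel cov p (γ τ)‖ * ‖chartVelocity (E := E) p γ τ‖ *
          ‖chartVelocity (E := E) p γ τ‖ := by
          rw [norm_neg]
          exact ContinuousLinearMap.le_opNorm₂ _ _ _
      _ ≤ B * (D * ‖velocity (E := E) γ τ‖) * ‖chartVelocity (E := E) p γ τ‖ := by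
          gcongr
          · exact hU.norm_christoffel_le _ (hγ hτ)
          · exact hU.norm_components_le _ (hγ hτ) _
      _ = _ := by ring
  have hgronwall := norm_le_mul_exp_abs_sub_of_norm_deriv_le hI
    (fun τ hτ ↦ h.hasDerivAt_chartVelocity (hIJ hτ) (hU.subset_source (hγ hτ)))
    (fun τ hτ ↦ (hasDerivAt_arcLength h.isOpen h.ordConnected h.contMDiffOn_one ht₀
      (hIJ hτ)).const_mul (B * D : ℝ)) hderiv hs ht
  rwa [← mul_sub, abs_mul, abs_of_nonneg (by positivity)] at hgronwall

theorem velocity_eq_zero_iff [T2Space M] {k : ℕ∞} [cov.ContMDiffCovariantDerivative k]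
    (h : IsGeodesicOn cov γ J) (hs : s ∈ J) (ht : t ∈ J) :
    velocity (E := E) γ s = 0 ↔ velocity (E := E) γ t = 0 := by
  refine h.isConnected.isPreconnected.induction₂
    (fun s t ↦ velocity (E := E) γ s = 0 ↔ velocity (E := E) γ t = 0) (fun s hs ↦ ?_)
    (fun _ _ _ _ _ _ ↦ Iff.trans) (fun _ _ _ _ ↦ Iff.symm) hs ht
  obtain ⟨U, hU, D, B, hctrl⟩ := exists_isControlled (k := k) cov (γ s)
  obtain ⟨b, c, hsI, hI⟩ := mem_nhds_iff_exists_Ioo_subset.1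
    (inter_mem (h.isOpen.mem_nhds hs) ((h.contMDiffAt hs).continuousAt hU))
  have hpropagate (t₁) (ht₁ : t₁ ∈ Ioo b c) (t₂) (ht₂ : t₂ ∈ Ioo b c)
      (hv : velocity (E := E) γ t₁ = 0) : velocity (E := E) γ t₂ = 0 := by
    rw [← components_eq_zero_iff (hctrl.subset_source (hI ht₂).2), ← norm_le_zero_iff]
    rw [← components_eq_zero_iff (hctrl.subset_source (hI ht₁).2)] at hv
    refine (h.norm_chartVelocity_le hctrl ordConnected_Ioo (fun τ hτ ↦ (hI hτ).1)
      (fun τ hτ ↦ (hI hτ).2) hs ht₁ ht₂).trans_eq ?_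
    rw [chartVelocity, hv, norm_zero, zero_mul]
  filter_upwards [mem_nhdsWithin_of_mem_nhds (Ioo_mem_nhds hsI.1 hsI.2)] with t ht
  exact ⟨hpropagate s hsI t ht, hpropagate t ht s hsI⟩

theorem exists_norm_chartVelocity_le_mul (h : IsGeodesicOn cov γ J)
    (hU : IsControlled cov p D B U) (hγ : MapsTo γ (J ∩ Ici a) U) (ha : a ∈ J) (ht₀ : t₀ ∈ J)
    (hL : BddAbove (arcLength (E := E) γ t₀ '' J)) :
    ∃ C ≥ 0, ∀ s ∈ J ∩ Ici a, ∀ t ∈ J ∩ Ici a,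
      ‖chartVelocity (E := E) p γ t‖ ≤ C * ‖chartVelocity (E := E) p γ s‖ := by
  obtain ⟨S, hS⟩ := hL
  set L := arcLength (E := E) γ t₀
  have hL_Icc (t) (ht : t ∈ J ∩ Ici a) : L t ∈ Icc (L a) S :=
    ⟨monotoneOn_arcLength h.isOpen h.ordConnected h.contMDiffOn_one ht₀ ha ht.1 ht.2,
      hS (mem_image_of_mem _ ht.1)⟩
  refine ⟨Real.exp (B * D * (S - L a)), (Real.exp_pos _).le, fun s hs t ht ↦ ?_⟩
  have hLst : |L t - L s| ≤ S - L a :=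
    abs_sub_le_of_le_of_le (hL_Icc t ht).1 (hL_Icc t ht).2 (hL_Icc s hs).1 (hL_Icc s hs).2
  rw [mul_comm]
  refine (h.norm_chartVelocity_le hU (h.ordConnected.inter ordConnected_Ici) inter_subset_left hγ
    ht₀ hs ht).trans ?_
  gcongr

theorem bddAbove_of_bddAbove_arcLength (h : IsGeodesicOn cov γ J)
    (hU : IsControlled cov p D B U) (hγ : MapsTo γ (J ∩ Ici a) U) (ha : a ∈ J)
    (hv : velocity (E := E) γ a ≠ 0) (ht₀ : t₀ ∈ J)
    (hL : BddAbove (arcLength (E := E) γ t₀ '' J)) : BddAbove J := by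
  obtain ⟨C, hC, hCle⟩ := h.exists_norm_chartVelocity_le_mul hU hγ ha ht₀ hL
  obtain ⟨S, hS⟩ := hL
  set L := arcLength (E := E) γ t₀
  set c := ‖chartVelocity (E := E) p γ a‖
  have hc : 0 < c :=
    norm_pos_iff.2 ((components_eq_zero_iff (hU.subset_source (hγ ⟨ha, self_mem_Ici⟩))).not.2 hv)
  have hspeed (t) (ht : t ∈ J ∩ Ici a) : c ≤ C * D * ‖velocity (E := E) γ t‖ :=
    calc c ≤ C * ‖chartVelocity (E := E) p γ t‖ := hCle t ht a ⟨ha, self_mem_Ici⟩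
      _ ≤ C * (D * ‖velocity (E := E) γ t‖) := by
          gcongr
          exact hU.norm_components_le _ (hγ ht) _
      _ = C * D * ‖velocity (E := E) γ t‖ := (mul_assoc _ _ _).symm
  have hderiv (t) (ht : t ∈ J ∩ Ici a) :
      HasDerivAt (fun τ ↦ C * D * L τ) (C * D * ‖velocity (E := E) γ t‖) t :=
    (hasDerivAt_arcLength h.isOpen h.ordConnected h.contMDiffOn_one ht₀ ht.1).const_mul _
  have hJa : Convex ℝ (J ∩ Ici a) := (h.ordConnected.inter ordConnected_Ici).convex
  refine ⟨a + C * D * (S - L a) / c, fun t ht ↦ ?_⟩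
  have hLS (τ) (hτ : τ ∈ J) : L τ ≤ S := hS (mem_image_of_mem L hτ)
  rcases le_total t a with hta | hat
  · have := sub_nonneg.2 (hLS a ha)
    exact hta.trans (le_add_of_nonneg_right (by positivity))
  · rw [← sub_le_iff_le_add', le_div_iff₀' hc]
    calc c * (t - a) ≤ C * D * L t - C * D * L a :=
          hJa.mul_sub_le_image_sub_of_le_deriv
            (fun τ hτ ↦ (hderiv τ hτ).continuousAt.continuousWithinAt)
            (fun τ hτ ↦ (hderiv τ (interior_subset hτ)).differentiableAt.differentiableWithinAt)
            (fun τ hτ ↦ (hspeed τ (interior_subset hτ)).trans_eq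
              (hderiv τ (interior_subset hτ)).deriv.symm)
            a ⟨ha, self_mem_Ici⟩ t ⟨ht, hat⟩ hat
      _ ≤ C * D * (S - L a) := by
          rw [← mul_sub]
          gcongr
          exact hLS t ht

theorem exists_tendsto_chartVelocity (h : IsGeodesicOn cov γ J) (hU : IsControlled cov p D B U)
    (hγ : MapsTo γ (J ∩ Ici a) U) (ha : a ∈ J) (ht₀ : t₀ ∈ J)
    (hL : BddAbove (arcLength (E := E) γ t₀ '' J)) {T : ℝ} (hT : IsLUB J T) :
    ∃ u₀, Tendsto (chartVelocity (E := E) p γ) (𝓝[<] T) (𝓝 u₀) := by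
  obtain ⟨C, hC, hCle⟩ := h.exists_norm_chartVelocity_le_mul hU hγ ha ht₀ hL
  have hmem (t) (ht : t ∈ Ioo a T) : t ∈ J ∩ Ici a :=
    ⟨Ioo_subset_of_isLUB h.ordConnected hT ha ht, ht.1.le⟩
  have : CompleteSpace E := FiniteDimensional.complete ℝ E
  set c := C * ‖chartVelocity (E := E) p γ a‖
  refine exists_tendsto_nhdsLT_of_norm_deriv_le (subset_Iio_of_isLUB h.isOpen hT ha)
    (C := B * c * c)
    (fun t ht ↦ h.hasDerivAt_chartVelocity (hmem t ht).1 (hU.subset_source (hγ (hmem t ht))))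
    fun t ht ↦ ?_
  have hu : ‖chartVelocity (E := E) p γ t‖ ≤ c := hCle a ⟨ha, self_mem_Ici⟩ t (hmem t ht)
  rw [norm_neg]
  refine (ContinuousLinearMap.le_opNorm₂ _ _ _).trans ?_
  gcongr
  exact hU.norm_christoffel_le _ (hγ (hmem t ht))

end IsGeodesicOn

end LocalBounds

section Complete

theorem cauchy_map_of_edist_le {α β X : Type*} [PseudoEMetricSpace α] [PseudoEMetricSpace β]
    {f : Filter X} {u : X → α} {v : X → β} (huv : ∀ x y, edist (u x) (u y) ≤ edist (v x) (v y))
    (hv : Cauchy (map v f)) : Cauchy (map u f) := by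
  rw [cauchy_map_iff, uniformity_basis_edist.tendsto_right_iff] at hv ⊢
  exact ⟨hv.1, fun ε hε ↦ (hv.2 ε hε).mono fun x hx ↦ (huv x.1 x.2).trans_lt hx⟩

variable {E : Type*} [NormedAddCommGroup E] [NormedSpace ℝ E]
  {M : Type*} [EMetricSpace M] [ChartedSpace E M] [IsManifold 𝓘(ℝ, E) ∞ M]
  [Bundle.RiemannianBundle (fun x : M ↦ TangentSpace 𝓘(ℝ, E) x)]
  [IsContinuousRiemannianBundle E (fun x : M ↦ TangentSpace 𝓘(ℝ, E) x)]
  [IsRiemannianManifold 𝓘(ℝ, E) M] {γ : ℝ → M} {J : Set ℝ} {t₀ : ℝ}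

theorem exists_tendsto_atTop_of_bddAbove_arcLength [CompleteSpace M] (hJ : IsOpen J)
    (hJ' : J.OrdConnected) (hγ : ContMDiffOn 𝓘(ℝ, ℝ) 𝓘(ℝ, E) 1 γ J) (ht₀ : t₀ ∈ J)
    (hL : BddAbove (arcLength (E := E) γ t₀ '' J)) :
    ∃ p, Tendsto (fun t : J ↦ γ t) atTop (𝓝 p) := by
  have : Nonempty J := ⟨⟨t₀, ht₀⟩⟩
  have hL_tendsto : Tendsto (J.domRestrict (arcLength (E := E) γ t₀)) atTop _ :=
    tendsto_atTop_ciSup (monotoneOn_iff_monotone.1 (monotoneOn_arcLength hJ hJ' hγ ht₀))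
      (by rwa [range_domRestrict])
  exact CompleteSpace.complete (cauchy_map_of_edist_le
    (fun s t ↦ edist_le_edist_arcLength hJ hJ' hγ ht₀ s.2 t.2) hL_tendsto.cauchy_map)

variable [FiniteDimensional ℝ E]
  {cov : CovariantDerivative 𝓘(ℝ, E) E (fun x : M ↦ TangentSpace 𝓘(ℝ, E) x)}

theorem IsGeodesicOn.velocity_ne_zero {k : ℕ∞} [cov.ContMDiffCovariantDerivative k]
    (h : IsGeodesicOn cov γ J)
    (hne : ∃ t₁ ∈ J, ∃ t₂ ∈ J, γ t₁ ≠ γ t₂) {t : ℝ} (ht : t ∈ J) :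
    velocity (E := E) γ t ≠ 0 := by
  obtain ⟨t₁, ht₁, t₂, ht₂, hne⟩ := hne
  refine fun hv ↦ hne (edist_le_zero.1 ?_)
  have hlength : arcLength (E := E) γ t₁ t₂ = 0 :=
    intervalIntegral.integral_zero_ae (.of_forall fun τ hτ ↦ norm_eq_zero.2 <|
      (h.velocity_eq_zero_iff (k := k) ht
        (h.ordConnected.uIcc_subset ht₁ ht₂ (uIoc_subset_uIcc hτ))).1 hv)
  calc edist (γ t₁) (γ t₂)
      ≤ edist (arcLength (E := E) γ t₁ t₁) (arcLength (E := E) γ t₁ t₂) :=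
        edist_le_edist_arcLength h.isOpen h.ordConnected h.contMDiffOn_one ht₁ ht₁ ht₂
    _ = 0 := by rw [arcLength_self, hlength, edist_self]

variable [CompleteSpace M] {k : ℕ∞} [cov.ContMDiffCovariantDerivative k]

theorem IsMaximalGeodesic.not_bddAbove_arcLength (hk : 1 ≤ k) (h : IsMaximalGeodesic cov γ J)
    (hv : ∀ t ∈ J, velocity (E := E) γ t ≠ 0) (ht₀ : t₀ ∈ J) :
    ¬ BddAbove (arcLength (E := E) γ t₀ '' J) := by
  intro hL
  have hg := h.isGeodesicOn
  have : Nonempty J := ⟨⟨t₀, ht₀⟩⟩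
  obtain ⟨p, hp⟩ := exists_tendsto_atTop_of_bddAbove_arcLength hg.isOpen hg.ordConnected
    hg.contMDiffOn_one ht₀ hL
  obtain ⟨U, hU, D, B, hctrl⟩ := exists_isControlled (k := k) cov p
  obtain ⟨⟨a, ha⟩, haU⟩ := eventually_atTop.1 (hp hU)
  have hγU : MapsTo γ (J ∩ Ici a) U := fun t ht ↦ haU ⟨t, ht.1⟩ ht.2
  have hT := isLUB_csSup hg.isConnected.nonempty
    (hg.bddAbove_of_bddAbove_arcLength hctrl hγU ha (hv a ha) ht₀ hL)
  obtain ⟨u₀, hu₀⟩ := hg.exists_tendsto_chartVelocity hctrl hγU ha ht₀ hL hT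
  refine h.not_tendsto_chartVelocity hk hT ?_ u₀ hu₀
  rwa [← map_coe_atTop_of_isLUB hg.isOpen hg.ordConnected hT, tendsto_map'_iff]

end Complete

section Reversal

variable {E : Type*} [NormedAddCommGroup E] [NormedSpace ℝ E]
  {M : Type*} [TopologicalSpace M] [ChartedSpace E M] [IsManifold 𝓘(ℝ, E) ∞ M]
  {γ : ℝ → M} {J : Set ℝ}

theorem chartVelocity_comp_neg {p : M} {t : ℝ} (hp : γ (-t) ∈ (chartAt E p).source) :
    chartVelocity (E := E) p (γ ∘ Neg.neg) t = -chartVelocity (E := E) p γ (-t) := by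
  rw [chartVelocity, velocity_comp_neg, ← neg_one_smul ℝ]
  exact (components_smul hp (-1) _).trans (neg_one_smul ℝ _)

variable [FiniteDimensional ℝ E]
  {cov : CovariantDerivative 𝓘(ℝ, E) E (fun x : M ↦ TangentSpace 𝓘(ℝ, E) x)}

theorem IsGeodesicOn.comp_neg (h : IsGeodesicOn cov γ J) :
    IsGeodesicOn cov (γ ∘ Neg.neg) (Neg.neg ⁻¹' J) where
  isOpen := h.isOpen.preimage continuous_neg
  isConnected := (Homeomorph.neg ℝ).isConnected_preimage.2 h.isConnected
  contMDiffOn := h.contMDiffOn.comp contDiff_neg.contMDiff.contMDiffOn subset_rfl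
  covAlong_eq_zero t ht := by
    have hsource : (chartAt E (γ (-t))).source ∈ 𝓝 (γ (-t)) := chart_source_mem_nhds E _
    have hγ : ContMDiffAt 𝓘(ℝ, ℝ) 𝓘(ℝ, E) 2 (γ ∘ Neg.neg) t :=
      (h.contMDiffAt ht).comp t contDiff_neg.contMDiff.contMDiffAt
    have hreverse : chartVelocity (E := E) (γ (-t)) (γ ∘ Neg.neg) =ᶠ[𝓝 t]
        fun τ ↦ -chartVelocity (E := E) (γ (-t)) γ (-τ) := by
      filter_upwards [hγ.continuousAt hsource] with τ hτ using chartVelocity_comp_neg hτ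
    have hderiv := (hasDerivAt_comp_neg
      (h.hasDerivAt_chartVelocity ht (mem_of_mem_nhds hsource))).neg
    rw [covAlong_velocity_eq_zero_iff (γ := γ ∘ Neg.neg) cov (mem_of_mem_nhds hsource) hγ,
      hreverse.eq_of_nhds]
    refine (hderiv.congr_of_eventuallyEq hreverse).congr_deriv ?_
    simp

theorem IsMaximalGeodesic.comp_neg (h : IsMaximalGeodesic cov γ J) :
    IsMaximalGeodesic cov (γ ∘ Neg.neg) (Neg.neg ⁻¹' J) where
  isGeodesicOn := h.isGeodesicOn.comp_neg
  maximal γ' J' h' hJ heq := by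
    have hJ' := h.maximal _ _ h'.comp_neg (fun t ht ↦ hJ (by simpa using ht)) fun t ht ↦ by
      simpa using heq (x := -t) (by simpa using ht)
    rw [← hJ', ← preimage_comp, neg_comp_neg, preimage_id]

end Reversal

section Unbounded

variable {E : Type*} [NormedAddCommGroup E] [NormedSpace ℝ E] [FiniteDimensional ℝ E]
  {M : Type*} [EMetricSpace M] [ChartedSpace E M] [IsManifold 𝓘(ℝ, E) ∞ M]
  [Bundle.RiemannianBundle (fun x : M ↦ TangentSpace 𝓘(ℝ, E) x)]
  [IsContinuousRiemannianBundle E (fun x : M ↦ TangentSpace 𝓘(ℝ, E) x)]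
  [IsRiemannianManifold 𝓘(ℝ, E) M] [CompleteSpace M]
  {cov : CovariantDerivative 𝓘(ℝ, E) E (fun x : M ↦ TangentSpace 𝓘(ℝ, E) x)}
  {k : ℕ∞} [cov.ContMDiffCovariantDerivative k] {γ : ℝ → M} {J : Set ℝ} {t₀ : ℝ}

theorem IsMaximalGeodesic.not_bddBelow_arcLength (hk : 1 ≤ k) (h : IsMaximalGeodesic cov γ J)
    (hv : ∀ t ∈ J, velocity (E := E) γ t ≠ 0) (ht₀ : t₀ ∈ J) :
    ¬ BddBelow (arcLength (E := E) γ t₀ '' J) := by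
  rintro ⟨b, hb⟩
  have hv_neg (t : ℝ) (ht : t ∈ Neg.neg ⁻¹' J) : velocity (E := E) (γ ∘ Neg.neg) t ≠ 0 := by
    rw [velocity_comp_neg]
    exact neg_ne_zero.2 (hv (-t) ht)
  refine h.comp_neg.not_bddAbove_arcLength (t₀ := -t₀) hk hv_neg (by simpa using ht₀) ⟨-b, ?_⟩
  rintro _ ⟨t, ht, rfl⟩
  rw [arcLength_comp_neg]
  exact neg_le_neg (hb (mem_image_of_mem _ ht))

theorem IsMaximalGeodesic.image_arcLength_eq_univ (hk : 1 ≤ k) (h : IsMaximalGeodesic cov γ J)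
    (hv : ∀ t ∈ J, velocity (E := E) γ t ≠ 0) (ht₀ : t₀ ∈ J) :
    arcLength (E := E) γ t₀ '' J = univ := by
  have hg := h.isGeodesicOn
  have hL : ContinuousOn (arcLength (E := E) γ t₀) J := fun t ht ↦ (hasDerivAt_arcLength
    hg.isOpen hg.ordConnected hg.contMDiffOn_one ht₀ ht).continuousAt.continuousWithinAt
  exact (hg.isConnected.isPreconnected.image _ hL).eq_univ_of_unbounded
    (h.not_bddBelow_arcLength hk hv ht₀) (h.not_bddAbove_arcLength hk hv ht₀)

end Unbounded

section InverseFunction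

variable {𝕜 : Type*} [NontriviallyNormedField 𝕜] [CompleteSpace 𝕜] {f f' : 𝕜 → 𝕜} {s : Set 𝕜}

theorem isOpen_image_of_hasStrictDerivAt (hs : IsOpen s)
    (hf : ∀ x ∈ s, HasStrictDerivAt f (f' x) x) (hf' : ∀ x ∈ s, f' x ≠ 0) :
    IsOpen (f '' s) := by
  rw [isOpen_iff_mem_nhds]
  rintro _ ⟨x, hx, rfl⟩
  rw [← (hf x hx).map_nhds_eq (hf' x hx)]
  exact image_mem_map (hs.mem_nhds hx)

theorem hasDerivAt_invFunOn (hs : IsOpen s) (hinj : InjOn f s)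
    (hf : ∀ x ∈ s, HasStrictDerivAt f (f' x) x) (hf' : ∀ x ∈ s, f' x ≠ 0)
    {y : 𝕜} (hy : y ∈ f '' s) :
    HasDerivAt (Function.invFunOn f s) (f' (Function.invFunOn f s y))⁻¹ y := by
  obtain ⟨x, hx, rfl⟩ := hy
  rw [hinj.leftInvOn_invFunOn hx]
  exact ((hf x hx).to_local_left_inverse (hf' x hx)
    (eventually_of_mem (hs.mem_nhds hx) hinj.leftInvOn_invFunOn)).hasDerivAt

theorem contDiffOn_one_invFunOn (hs : IsOpen s) (hinj : InjOn f s)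
    (hf : ∀ x ∈ s, HasStrictDerivAt f (f' x) x) (hf' : ∀ x ∈ s, f' x ≠ 0)
    (hf'_cont : ContinuousOn f' s) : ContDiffOn 𝕜 1 (Function.invFunOn f s) (f '' s) := by
  have hderiv (y : 𝕜) (hy : y ∈ f '' s) := hasDerivAt_invFunOn hs hinj hf hf' hy
  have hmem : MapsTo (Function.invFunOn f s) (f '' s) s := fun _ ↦ Function.invFunOn_mem
  rw [← zero_add 1, contDiffOn_succ_iff_deriv_of_isOpen
    (isOpen_image_of_hasStrictDerivAt hs hf hf'), contDiffOn_zero]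
  refine ⟨fun y hy ↦ (hderiv y hy).differentiableAt.differentiableWithinAt, by simp, ?_⟩
  exact ((hf'_cont.comp (fun y hy ↦ (hderiv y hy).continuousAt.continuousWithinAt)
    hmem).inv₀ fun y hy ↦ hf' _ (hmem hy)).congr fun y hy ↦ (hderiv y hy).deriv

end InverseFunction

section UnitSpeed

theorem exists_eq_add_of_abs_deriv_eq_one {f f' : ℝ → ℝ} {S : Set ℝ} (hS : IsOpen S)
    (hS' : IsPreconnected S) (hf : ∀ s ∈ S, HasDerivAt f (f' s) s) (hf' : ∀ s ∈ S, |f' s| = 1) :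
    ∃ ε a : ℝ, ε ≠ 0 ∧ EqOn f (fun s ↦ ε * s + a) S := by
  obtain ⟨ε, hε, hf'ε⟩ : ∃ ε : ℝ, ε ≠ 0 ∧ ∀ s ∈ S, f' s = ε := by
    rcases hasDerivWithinAt_forall_lt_or_forall_gt_of_forall_ne hS'.ordConnected.convex
      (fun s hs ↦ (hf s hs).hasDerivWithinAt) (m := 0)
      (fun s hs h ↦ by simpa [h] using hf' s hs) with hneg | hpos
    · exact ⟨-1, by simp, fun s hs ↦ by rw [← hf' s hs, abs_of_neg (hneg s hs), neg_neg]⟩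
    · exact ⟨1, one_ne_zero, fun s hs ↦ by rw [← hf' s hs, abs_of_pos (hpos s hs)]⟩
  obtain ⟨a, ha⟩ := hS.exists_eq_add_of_deriv_eq hS'
    (fun s hs ↦ (hf s hs).differentiableAt.differentiableWithinAt)
    (differentiable_id.const_mul ε).differentiableOn
    fun s hs ↦ by simp [(hf s hs).deriv, hf'ε s hs]
  exact ⟨ε, a, hε, ha⟩

theorem eq_univ_of_image_eq_univ_of_abs_deriv_eq_one {f f' : ℝ → ℝ} {S : Set ℝ} (hS : IsOpen S)
    (hS' : IsPreconnected S) (hf : ∀ s ∈ S, HasDerivAt f (f' s) s) (hf' : ∀ s ∈ S, |f' s| = 1)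
    (hfS : f '' S = univ) : S = univ := by
  obtain ⟨ε, a, hε, heq⟩ := exists_eq_add_of_abs_deriv_eq_one hS hS' hf hf'
  refine eq_univ_of_forall fun x ↦ ?_
  obtain ⟨s, hs, hsx⟩ : ε * x + a ∈ f '' S := hfS ▸ mem_univ _
  rw [heq hs, add_left_inj, mul_right_inj' hε] at hsx
  exact hsx ▸ hs

variable {E : Type*} [NormedAddCommGroup E] [NormedSpace ℝ E]
  {M : Type*} [TopologicalSpace M] [ChartedSpace E M]
  [Bundle.RiemannianBundle (fun x : M ↦ TangentSpace 𝓘(ℝ, E) x)]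

theorem norm_velocity_congr {γ γ' : ℝ → M} {t : ℝ} (h : γ =ᶠ[𝓝 t] γ') :
    ‖velocity (E := E) γ t‖ = ‖velocity (E := E) γ' t‖ := by
  let n (x : M) (v : E) : ℝ := norm (E := TangentSpace 𝓘(ℝ, E) x) v
  change n (γ t) (velocity (E := E) γ t) = n (γ' t) (velocity (E := E) γ' t)
  rw [h.eq_of_nhds, velocity_congr h]

variable [IsManifold 𝓘(ℝ, E) ∞ M]
  [IsContinuousRiemannianBundle E (fun x : M ↦ TangentSpace 𝓘(ℝ, E) x)]
  {γ r : ℝ → M} {J S : Set ℝ} {t₀ : ℝ}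

theorem IsArcLengthParametrization.eq_univ (h : IsArcLengthParametrization (E := E) γ J r S)
    (hJ : IsOpen J) (hJ' : J.OrdConnected) (hγ : ContMDiffOn 𝓘(ℝ, ℝ) 𝓘(ℝ, E) 1 γ J)
    (ht₀ : t₀ ∈ J) (hL : arcLength (E := E) γ t₀ '' J = univ) : S = univ := by
  obtain ⟨φ, hφ, hbij, hr⟩ := h.exists_reparam
  have hφ' (s : ℝ) (hs : s ∈ S) : HasDerivAt φ (deriv φ s) s :=
    ((hφ.contDiffAt (h.isOpen.mem_nhds hs)).differentiableAt one_ne_zero).hasDerivAt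
  refine eq_univ_of_image_eq_univ_of_abs_deriv_eq_one h.isOpen h.isConnected.isPreconnected
    (f := arcLength (E := E) γ t₀ ∘ φ)
    (fun s hs ↦ (hasDerivAt_arcLength hJ hJ' hγ ht₀ (hbij.mapsTo hs)).comp s (hφ' s hs))
    (fun s hs ↦ ?_) (by rw [image_comp, hbij.image_eq, hL])
  have hγφ : MDiffAt γ (φ s) :=
    (hγ.contMDiffAt (hJ.mem_nhds (hbij.mapsTo hs))).mdifferentiableAt one_ne_zero
  rw [abs_mul, abs_norm, mul_comm, ← Real.norm_eq_abs, ← norm_smul, ← velocity_comp hγφ (hφ' s hs),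
    ← norm_velocity_congr (eventuallyEq_of_mem (h.isOpen.mem_nhds hs) hr)]
  exact h.unit_speed s hs

theorem injOn_arcLength (hJ : IsOpen J) (hJ' : J.OrdConnected)
    (hγ : ContMDiffOn 𝓘(ℝ, ℝ) 𝓘(ℝ, E) 1 γ J) (hv : ∀ t ∈ J, velocity (E := E) γ t ≠ 0)
    (ht₀ : t₀ ∈ J) : InjOn (arcLength (E := E) γ t₀) J := by
  have hL (t : ℝ) (ht : t ∈ J) := hasDerivAt_arcLength hJ hJ' hγ ht₀ ht
  refine (strictMonoOn_of_deriv_pos hJ'.convex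
    (fun t ht ↦ (hL t ht).continuousAt.continuousWithinAt) fun t ht ↦ ?_).injOn
  rw [(hL t (interior_subset ht)).deriv]
  exact norm_pos_iff.2 (hv t (interior_subset ht))

theorem exists_isArcLengthParametrization (hJ : IsOpen J) (hJ' : IsConnected J)
    (hγ : ContMDiffOn 𝓘(ℝ, ℝ) 𝓘(ℝ, E) 1 γ J) (hv : ∀ t ∈ J, velocity (E := E) γ t ≠ 0) :
    ∃ r S, IsArcLengthParametrization (E := E) γ J r S := by
  have hJo := hJ'.isPreconnected.ordConnected
  obtain ⟨t₀, ht₀⟩ := hJ'.nonempty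
  set L := arcLength (E := E) γ t₀
  set φ := Function.invFunOn L J
  have hL (t : ℝ) (ht : t ∈ J) := hasStrictDerivAt_arcLength (E := E) hJ hJo hγ ht₀ ht
  have hv_norm (t : ℝ) (ht : t ∈ J) : ‖velocity (E := E) γ t‖ ≠ 0 := norm_ne_zero_iff.2 (hv t ht)
  have hinj : InjOn L J := injOn_arcLength hJ hJo hγ hv ht₀
  have hbij : BijOn φ (L '' J) J := hinj.bijOn_image.invOn_invFunOn.symm.bijOn
    (fun _ ↦ Function.invFunOn_mem) (mapsTo_image L J)
  have hL_cont : ContinuousOn L J := fun t ht ↦ (hL t ht).hasDerivAt.continuousAt.continuousWithinAt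
  refine ⟨γ ∘ φ, L '' J, isOpen_image_of_hasStrictDerivAt hJ hL hv_norm, hJ'.image L hL_cont,
    ⟨φ, contDiffOn_one_invFunOn hJ hinj hL hv_norm (continuousOn_speed hJ hγ), hbij,
      fun _ _ ↦ rfl⟩, fun s hs ↦ ?_⟩
  have hγφ : MDiffAt γ (φ s) :=
    (hγ.contMDiffAt (hJ.mem_nhds (hbij.mapsTo hs))).mdifferentiableAt one_ne_zero
  rw [velocity_comp hγφ (hasDerivAt_invFunOn hJ hinj hL hv_norm hs), norm_smul, norm_inv, norm_norm]
  exact inv_mul_cancel₀ (hv_norm _ (hbij.mapsTo hs))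

theorem curveLength_eq_top (hJ : IsOpen J) (hJ' : J.OrdConnected)
    (hγ : ContMDiffOn 𝓘(ℝ, ℝ) 𝓘(ℝ, E) 1 γ J) (ht₀ : t₀ ∈ J)
    (hL : ¬ BddAbove (arcLength (E := E) γ t₀ '' J)) : curveLength (E := E) γ J = ⊤ := by
  refine ENNReal.eq_top_of_forall_nnreal_le fun b ↦ ?_
  obtain ⟨_, ⟨t, ht, rfl⟩, hbt⟩ := not_bddAbove_iff.1 hL b
  calc (b : ENNReal) = ENNReal.ofReal b := ENNReal.ofReal_coe_nnreal.symm
    _ ≤ ENNReal.ofReal (arcLength (E := E) γ t₀ t) := ENNReal.ofReal_le_ofReal hbt.le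
    _ ≤ curveLength (E := E) γ J := ofReal_arcLength_le_curveLength hJ hJ' hγ ht₀ ht

end UnitSpeed

theorem isContinuousRiemannianBundle_of_isContMDiffRiemannianBundle
    {E H B F : Type*} [NormedAddCommGroup E] [NormedSpace ℝ E] [TopologicalSpace H]
    {I : ModelWithCorners ℝ E H} {n : WithTop ℕ∞} [TopologicalSpace B] [ChartedSpace H B]
    [NormedAddCommGroup F] [NormedSpace ℝ F] {V : B → Type*}
    [TopologicalSpace (Bundle.TotalSpace F V)] [∀ x, NormedAddCommGroup (V x)]
    [∀ x, InnerProductSpace ℝ (V x)] [FiberBundle F V] [VectorBundle ℝ F V]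
    [IsContMDiffRiemannianBundle I n F V] : IsContinuousRiemannianBundle F V := by
  obtain ⟨g, hg, h⟩ := IsContMDiffRiemannianBundle.exists_contMDiff (IB := I) (n := n)
    (F := F) (E := V)
  exact ⟨g, hg.continuous, h⟩

end AffineGeodesic

theorem proposition3p7_general
    {E : Type*} [NormedAddCommGroup E] [NormedSpace ℝ E] [FiniteDimensional ℝ E]
    {M : Type*} [EMetricSpace M] [ChartedSpace E M] [IsManifold 𝓘(ℝ, E) ∞ M]
    [Bundle.RiemannianBundle (fun x : M ↦ TangentSpace 𝓘(ℝ, E) x)]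
    [IsContinuousRiemannianBundle E (fun x : M ↦ TangentSpace 𝓘(ℝ, E) x)]
    [IsRiemannianManifold 𝓘(ℝ, E) M] [CompleteSpace M]
    (cov : CovariantDerivative 𝓘(ℝ, E) E (fun x : M ↦ TangentSpace 𝓘(ℝ, E) x))
    {k : ℕ∞} (hk : 1 ≤ k) [cov.ContMDiffCovariantDerivative k]
    (γ : ℝ → M) (J : Set ℝ)
    (hγ : AffineGeodesic.IsMaximalGeodesic cov γ J)
    (hnonconst : ∃ t₁ ∈ J, ∃ t₂ ∈ J, γ t₁ ≠ γ t₂) :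
    (∃ (r : ℝ → M) (S : Set ℝ),
      AffineGeodesic.IsArcLengthParametrization (E := E) γ J r S) ∧
    (∀ (r : ℝ → M) (S : Set ℝ),
      AffineGeodesic.IsArcLengthParametrization (E := E) γ J r S → S = univ) ∧
    AffineGeodesic.curveLength (E := E) γ J = ⊤ := by
  have hg := hγ.isGeodesicOn
  obtain ⟨t₀, ht₀⟩ := hg.isConnected.nonempty
  have hv (t : ℝ) (ht : t ∈ J) : AffineGeodesic.velocity (E := E) γ t ≠ 0 :=
    hg.velocity_ne_zero (k := k) hnonconst ht
  exact ⟨AffineGeodesic.exists_isArcLengthParametrization hg.isOpen hg.isConnected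
      hg.contMDiffOn_one hv,
    fun _ _ hr ↦ hr.eq_univ hg.isOpen hg.ordConnected hg.contMDiffOn_one ht₀
      (hγ.image_arcLength_eq_univ hk hv ht₀),
    AffineGeodesic.curveLength_eq_top hg.isOpen hg.ordConnected hg.contMDiffOn_one ht₀
      (hγ.not_bddAbove_arcLength hk hv ht₀)⟩

theorem proposition3p7
    {E : Type*} [NormedAddCommGroup E] [NormedSpace ℝ E] [FiniteDimensional ℝ E]
    {M : Type*} [EMetricSpace M] [ChartedSpace E M] [IsManifold 𝓘(ℝ, E) ∞ M]
    [Bundle.RiemannianBundle (fun x : M ↦ TangentSpace 𝓘(ℝ, E) x)]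
    [IsContMDiffRiemannianBundle 𝓘(ℝ, E) ∞ E (fun x : M ↦ TangentSpace 𝓘(ℝ, E) x)]
    [IsRiemannianManifold 𝓘(ℝ, E) M] [CompleteSpace M]
    (cov : CovariantDerivative 𝓘(ℝ, E) E (fun x : M ↦ TangentSpace 𝓘(ℝ, E) x))
    [cov.ContMDiffCovariantDerivative ∞]
    (γ : ℝ → M) (J : Set ℝ)
    (hγ : AffineGeodesic.IsMaximalGeodesic cov γ J)
    (hnonconst : ∃ t₁ ∈ J, ∃ t₂ ∈ J, γ t₁ ≠ γ t₂) :
    (∃ (r : ℝ → M) (S : Set ℝ),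
      AffineGeodesic.IsArcLengthParametrization (E := E) γ J r S) ∧
    (∀ (r : ℝ → M) (S : Set ℝ),
      AffineGeodesic.IsArcLengthParametrization (E := E) γ J r S → S = univ) ∧
    AffineGeodesic.curveLength (E := E) γ J = ⊤ := by
  have : IsContinuousRiemannianBundle E (fun x : M ↦ TangentSpace 𝓘(ℝ, E) x) :=
    AffineGeodesic.isContinuousRiemannianBundle_of_isContMDiffRiemannianBundle
      (I := 𝓘(ℝ, E)) (n := ∞)
  exact proposition3p7_general cov (k := ⊤) le_top γ J hγ hnonconst
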